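/- For $Q\in\mathbb N$ let $\mathcal F_Q=\{p/q\in[0,1): p,q\in\mathbb Z,\ \gcd(p,q)=1,\ 0<q\le Q\}$ be the Farey points of level $Q$, regarded as points of $\mathbb T=\mathbb R/\mathbb Z$, and let $\sigma_Q=\frac{Q^2}{2\zeta(2)}=\frac{3Q^2}{\pi^2}$. For $\mathcal D\subset\mathbb T$, $A\subset\mathbb R$ and an integer $k\ge 0$ put $$P_{0,Q}(k,\mathcal D,A)=\frac{\big|\{r\in\mathcal F_Q\cap\mathcal D:\ |(r+\sigma_Q^{-1}A+\mathbb Z)\cap\mathcal F_Q|=k\}\big|}{|\mathcal F_Q\cap\mathcal D|}.$$ Let $\widehat{\mathbb Z}^2=\{(p,q)\in\mathbb Z^2:\gcd(p,q)=1\}$ (row vectors), let $\mathfrak C_\lambda(A)=\{(x\lambda^{1/2},y\lambda^{-1/2}): 0<y\le 1,\ x\in\sigma_1^{-1}yA\}$ for $0<\lambda\le1$, and put $$P_0(k,A)=\int_0^1 \operatorname{meas}\Big\{b\in[0,1):\ \Big|\widehat{\mathbb Z}^2\begin{pmatrix}1&b\\0&1\end{pmatrix}\cap\mathfrak C_\lambda(A)\Big|=k\Big\}\,d\lambda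 .$$ Let $s>0$ and $a=\big(\tfrac{\pi^2}{3}s\big)^{-1}$. Then: (i) For every $\mathcal D\subset\mathbb T$ with non-empty interior and with boundary of Lebesgue measure zero, $$\lim_{Q\to\infty}P_{0,Q}(0,\mathcal D,(0,s])=P_0(0,(0,s]).$$ (ii) The limiting gap distribution is $$P_0(0,(0,s])=\begin{cases}1 & \text{if } a\ge 1,\\ -1+2a-2a\log a & \text{if } \tfrac14\le a\le 1,\\ -1+2a+2\sqrt{\tfrac14-a}-4a\log\big(\tfrac12+\sqrt{\tfrac14-a}\big) & \text{if } 0<a\le\tfrac14.\end{cases}$$ (iii) The function $s\mapsto P_0(0,(0,s])$ is differentiable on $(0,\infty)$, and $$-\frac{d}{ds}P_0(0,(0,s])=\begin{cases}0 & \text{if } a\ge 1,\\ -\tfrac{2\pi^2}{3}a^2\log a & \text{if } \tfrac14\le a\le 1,\\ -\tfrac{4\pi^2}{3}a^2\log\big(\tfrac12+\sqrt{\tfrac14-a}\big) & \text{if } 0<a\le\tfrac14.\end{cases}$$ -/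

import Mathlib

open MeasureTheory Set Filter Topology
open scoped Matrix Pointwise

noncomputable section

namespace Farey

/-- The Farey points `p / q ∈ [0, 1)` of level `Q`: `gcd (p, q) = 1` and `0 < q ≤ Q`. -/
def points (Q : ℕ) : Set ℝ :=
  {x | x ∈ Ico (0 : ℝ) 1 ∧
    ∃ p q : ℤ, Int.gcd p q = 1 ∧ 0 < q ∧ q ≤ (Q : ℤ) ∧ x = (p : ℝ) / (q : ℝ)}

/-- The normalisation `σ_Q = Q² / (2 ζ(2))`, asymptotic to the number of Farey points. -/
def sigma (Q : ℕ) : ℝ := (Q : ℝ) ^ 2 / (2 * (riemannZeta 2).re)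

/-- The set `(r + σ_Q⁻¹ A + ℤ) ∩ F_Q`. -/
def near (Q : ℕ) (A : Set ℝ) (r : ℝ) : Set ℝ :=
  {x | ∃ t ∈ A, ∃ m : ℤ, x = r + (sigma Q)⁻¹ * t + (m : ℝ)} ∩ points Q

/-- The Farey points that lie in a subset `D` of the torus `𝕋 = ℝ / ℤ`. -/
def pointsIn (Q : ℕ) (D : Set UnitAddCircle) : Set ℝ :=
  {r | r ∈ points Q ∧ (r : UnitAddCircle) ∈ D}

/-- `P_{0,Q}(k, D, A)`: the proportion of the Farey points `r ∈ F_Q ∩ D` for which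
`(r + σ_Q⁻¹ A + ℤ) ∩ F_Q` has exactly `k` elements. -/
def P0Q (Q k : ℕ) (D : Set UnitAddCircle) (A : Set ℝ) : ℝ :=
  ({r | r ∈ pointsIn Q D ∧ (near Q A r).encard = (k : ℕ∞)}.ncard : ℝ) /
    ((pointsIn Q D).ncard : ℝ)

/-- The diagonal matrix `a(y) = diag (y, y⁻¹)`. -/
def aMat (y : ℝ) : Matrix (Fin 2) (Fin 2) ℝ := !![y, 0; 0, y⁻¹]

/-- The matrix with rows `(1, b)` and `(0, 1)`. These matrices form the stabiliser `H` of the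
row vector `(0, 1)` in `SL(2, ℝ)`, and those with `b ∈ ℤ` form `Γ_H = H ∩ SL(2, ℤ)`. -/
def hMat (b : ℝ) : Matrix (Fin 2) (Fin 2) ℝ := !![1, b; 0, 1]

/-- The primitive integer vectors `ℤ̂²`, as row vectors in `ℝ²`. -/
def primitive : Set (Fin 2 → ℝ) :=
  {v | ∃ p q : ℤ, Int.gcd p q = 1 ∧ v = ![(p : ℝ), (q : ℝ)]}

/-- The cone `{(x, y) : 0 < y ≤ 1, x ∈ σ_1⁻¹ y A}`. -/
def cone (A : Set ℝ) : Set (Fin 2 → ℝ) :=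
  {v | 0 < v 1 ∧ v 1 ≤ 1 ∧ v 0 ∈ ((sigma 1)⁻¹ * v 1) • A}

/-- The rescaled cone `cone A · a(√l)`; vectors are row vectors. -/
def coneScaled (l : ℝ) (A : Set ℝ) : Set (Fin 2 → ℝ) :=
  (fun v => v ᵥ* aMat (Real.sqrt l)) '' cone A

/-- `p_0(k, C) = μ_H {M ∈ Γ_H \ H : |ℤ̂² M ∩ C| = k}`. The quotient `Γ_H \ H` is the circle
`ℝ / ℤ` in the coordinate `b` of `hMat b`, with `[0, 1)` as a fundamental domain, and `μ_H` is
Lebesgue measure `db`. -/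
def p0 (k : ℕ) (C : Set (Fin 2 → ℝ)) : ℝ :=
  (volume : Measure ℝ).real {b | b ∈ Ico (0 : ℝ) 1 ∧
    (((fun v => v ᵥ* hMat b) '' primitive) ∩ C).encard = (k : ℕ∞)}

/-- `P_0(k, A) = ∫_0^1 p_0(k, cone A · a(√l)) dl`. -/
def P0 (k : ℕ) (A : Set ℝ) : ℝ :=
  ∫ l in (0 : ℝ)..1, p0 k (coneScaled l A)

end Farey

end

/-! If `p / q` and its successor in the Farey sequence of level `Q` have denominators `q` and `n`,
then `n` is the representative of `-p⁻¹` modulo `q` in the window `(Q - q, Q]`, and the gap is `1 /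
(q n)`. As `σ_Q / s = a Q²`, the gap exceeds `s / σ_Q` exactly when `q n < a Q²`. With `t = q / Q`
this selects an initial part of the window, of relative length `gapProfile a t`. Everything thus
reduces to counting the `n` in a subinterval of the window that are units modulo `q` with `-n⁻¹ / q
∈ D`.

For large `q` the pairs `(n / q, -n⁻¹ / q)` equidistribute in the torus. Their Weyl sums are
Kloosterman sums, and Kloosterman's fourth moment argument already shows that these are `o(φ(q))`.
The count is therefore `vol(D) φ(q) gapProfile a (q / Q) + o(φ(q))`, uniformly in the position of
the window. Since `Q⁻² ∑ φ(q) h(q / Q)` tends to a nonzero constant times `∫ t h(t) dt`, both the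
constant and `vol(D)` cancel in the quotient, and the limit is `∫ 2 t gapProfile a t dt` over `[0,
1]`.

On the other side, put `l = t²`. A translate of the primitive vectors meets the scaled cone iff it
does so on the line `u = 1`, that is, iff `b + ℤ` meets `[a / t², 1 / t]`. The set of `b` that miss
it has measure `gapProfile a t` again, and the substitution `l = t²` yields the same integral. The
three regimes in `a` reflect where the clamps in `gapProfile` act: `t² - t + a` becomes negative
somewhere only if `a < 1/4`. -/

noncomputable section

namespace Farey

/-! ### Kloosterman sums and their fourth moment -/

section Kloosterman

variable {q : ℕ} [NeZero q]

/-- The number of solutions `y` of `x y = 0` in `ℤ / q`. -/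
def annCard (x : ZMod q) : ℕ := (Finset.univ.filter fun y : ZMod q => x * y = 0).card

lemma annCard_natCast_le {n : ℕ} (hn : 0 < n) : annCard (n : ZMod q) ≤ n := by
  classical
  have h := IsAddCyclic.card_nsmul_eq_zero_le (α := ZMod q) hn
  unfold annCard
  convert h using 4
  simp

lemma annCard_intCast_le {n : ℤ} (hn : n ≠ 0) : annCard (n : ZMod q) ≤ n.natAbs := by
  have h := annCard_natCast_le (q := q) (Int.natAbs_pos.2 hn)
  have h' : annCard (n : ZMod q) = annCard ((n.natAbs : ℕ) : ZMod q) := by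
    rcases abs_choice n with h | h <;> simp [annCard, h]
  exact h' ▸ h

/-- Multiplication by `y` maps the annihilator of `x y` into that of `x`, and each fibre lies in a
translate of the annihilator of `y`. -/
lemma annCard_mul_le (x y : ZMod q) : annCard (x * y) ≤ annCard x * annCard y := by
  unfold annCard
  set s := Finset.univ.filter fun z : ZMod q => x * y * z = 0
  have h1 : s.card ≤ (Finset.univ.filter fun z : ZMod q => y * z = 0).card *
      (s.image fun z => y * z).card := by
    apply Finset.card_le_mul_card_image
    intro b hb
    obtain ⟨z₀, -, hz₀⟩ := Finset.mem_image.1 hb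
    apply Finset.card_le_card_of_injOn (fun z => z - z₀)
    · intro z hz
      simp only [Finset.coe_filter, Finset.mem_univ, true_and, mem_ofPred_eq] at hz ⊢
      rw [mul_sub, hz.2, hz₀, sub_self]
    · intro z _ w _ h
      simpa using h
  have h2 : (s.image fun z => y * z).card ≤
      (Finset.univ.filter fun z : ZMod q => x * z = 0).card := by
    apply Finset.card_le_card
    intro b hb
    obtain ⟨z, hz, rfl⟩ := Finset.mem_image.1 hb
    simpa [s, mul_assoc] using hz
  calc s.card ≤ _ := h1
    _ ≤ _ := Nat.mul_le_mul_left _ h2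
    _ = _ := mul_comm _ _

/-- By Bézout the gcd is a multiple of `x` modulo `q`, so it kills whatever `x` kills. -/
lemma annCard_le_gcd (x : ZMod q) : annCard x ≤ Nat.gcd x.val q := by
  have hpos : 0 < Nat.gcd x.val q := Nat.gcd_pos_of_pos_right _ (NeZero.pos q)
  refine le_trans (Finset.card_le_card ?_) (annCard_natCast_le (q := q) hpos)
  intro y hy
  simp only [Finset.mem_filter, Finset.mem_univ, true_and] at hy ⊢
  have h := congrArg (fun z : ℤ => (z : ZMod q)) (Nat.gcd_eq_gcd_ab x.val q)
  simp only [Int.cast_natCast, Int.cast_add, Int.cast_mul, ZMod.natCast_zmod_val,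
    ZMod.natCast_self, zero_mul, add_zero] at h
  rw [h, mul_right_comm, hy, zero_mul]

/-- The gcd is at most the sum of all `d ∣ q` that divide `x`. Each `d` divides at most `q / d`
residues, hence contributes at most `q`. -/
lemma sum_annCard_le : ∑ x : ZMod q, annCard x ≤ q * q.divisors.card := by
  have h1 : ∀ x : ZMod q, annCard x ≤ ∑ d ∈ q.divisors, if d ∣ x.val then d else 0 := by
    intro x
    refine (annCard_le_gcd x).trans ?_
    have hm : Nat.gcd x.val q ∈ q.divisors :=
      Nat.mem_divisors.2 ⟨Nat.gcd_dvd_right _ _, NeZero.ne q⟩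
    have := Finset.single_le_sum (f := fun d => if d ∣ x.val then d else 0)
      (fun _ _ => Nat.zero_le _) hm
    simpa [Nat.gcd_dvd_left] using this
  calc ∑ x : ZMod q, annCard x
      ≤ ∑ x : ZMod q, ∑ d ∈ q.divisors, (if d ∣ x.val then d else 0) :=
        Finset.sum_le_sum fun x _ => h1 x
    _ = ∑ d ∈ q.divisors, ∑ x : ZMod q, (if d ∣ x.val then d else 0) := Finset.sum_comm
    _ ≤ ∑ d ∈ q.divisors, q := by
        apply Finset.sum_le_sum
        intro d hd
        have hdq := Nat.dvd_of_mem_divisors hd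
        have hd0 : 0 < d := Nat.pos_of_mem_divisors hd
        have hk : 0 < q / d := Nat.div_pos (Nat.le_of_dvd (NeZero.pos q) hdq) hd0
        rw [← Finset.sum_filter, Finset.sum_const, smul_eq_mul]
        have : (Finset.univ.filter fun x : ZMod q => d ∣ x.val).card ≤ q / d := by
          refine le_trans (Finset.card_le_card ?_) (annCard_natCast_le (q := q) hk)
          intro x hx
          simp only [Finset.mem_filter, Finset.mem_univ, true_and] at hx ⊢
          obtain ⟨e, he⟩ := hx
          have hx' : x = ((d * e : ℕ) : ZMod q) := by rw [← he, ZMod.natCast_zmod_val]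
          rw [hx', ← Nat.cast_mul, ← mul_assoc, Nat.div_mul_cancel hdq]
          simp
        calc _ ≤ q / d * d := Nat.mul_le_mul_right _ this
          _ = q := Nat.div_mul_cancel hdq
    _ = _ := by rw [Finset.sum_const, smul_eq_mul, mul_comm]

/-- The Kloosterman sum `∑_u e((m u + n u⁻¹) / q)` over the units modulo `q`. -/
def kloosterman (m n : ZMod q) : ℂ :=
  ∑ u : (ZMod q)ˣ, ZMod.stdAddChar (m * (u : ZMod q) + n * ((u⁻¹ : (ZMod q)ˣ) : ZMod q))

lemma kloosterman_comm (m n : ZMod q) : kloosterman m n = kloosterman n m := by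
  unfold kloosterman
  refine Fintype.sum_equiv (Equiv.inv _) _ _ fun u => ?_
  simp [add_comm]

/-- Substitute `u ↦ v u`. One large Kloosterman sum thus forces a whole orbit of equally large ones,
which is what makes a moment bound effective for a single sum. -/
lemma kloosterman_mul_unit (m n : ZMod q) (v : (ZMod q)ˣ) :
    kloosterman (m * (v : ZMod q)) (n * ((v⁻¹ : (ZMod q)ˣ) : ZMod q)) = kloosterman m n := by
  unfold kloosterman
  refine Fintype.sum_equiv (Equiv.mulLeft v) _ _ fun u => ?_
  simp only [Equiv.coe_mulLeft, mul_inv, Units.val_mul, mul_assoc]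

/-- The quadruples of units with `u₁ + u₂ = u₃ + u₄` and `u₁⁻¹ + u₂⁻¹ = u₃⁻¹ + u₄⁻¹`. -/
def energySet (q : ℕ) [NeZero q] :
    Finset ((ZMod q)ˣ × (ZMod q)ˣ × (ZMod q)ˣ × (ZMod q)ˣ) :=
  Finset.univ.filter fun t =>
    (t.1 : ZMod q) + t.2.1 - t.2.2.1 - t.2.2.2 = 0 ∧
    ((t.1⁻¹ : (ZMod q)ˣ) : ZMod q) + ((t.2.1⁻¹ : (ZMod q)ˣ) : ZMod q)
      - ((t.2.2.1⁻¹ : (ZMod q)ˣ) : ZMod q) - ((t.2.2.2⁻¹ : (ZMod q)ˣ) : ZMod q) = 0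

/-- Expand the fourth power over quadruples of units. Orthogonality in `m` and in `n` keeps the
quadruples satisfying both equations, each with weight `q²`. -/
lemma sum_norm_kloosterman_pow_four :
    ∑ m : ZMod q, ∑ n : ZMod q, ‖kloosterman m n‖ ^ 4 = (q : ℝ) ^ 2 * (energySet q).card := by
  set A : ((ZMod q)ˣ × (ZMod q)ˣ × (ZMod q)ˣ × (ZMod q)ˣ) → ZMod q := fun t =>
    (t.1 : ZMod q) + t.2.1 - t.2.2.1 - t.2.2.2 with hA
  set B : ((ZMod q)ˣ × (ZMod q)ˣ × (ZMod q)ˣ × (ZMod q)ˣ) → ZMod q := fun t =>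
    ((t.1⁻¹ : (ZMod q)ˣ) : ZMod q) + ((t.2.1⁻¹ : (ZMod q)ˣ) : ZMod q)
      - ((t.2.2.1⁻¹ : (ZMod q)ˣ) : ZMod q) - ((t.2.2.2⁻¹ : (ZMod q)ˣ) : ZMod q) with hB
  have hpow : ∀ m n : ZMod q, ((‖kloosterman m n‖ ^ 4 : ℝ) : ℂ) =
      ∑ t, (ZMod.stdAddChar (m * A t) * ZMod.stdAddChar (n * B t) : ℂ) := by
    intro m n
    have h1 : ((‖kloosterman m n‖ ^ 4 : ℝ) : ℂ) = kloosterman m n * (kloosterman m n *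
        ((starRingEnd ℂ) (kloosterman m n) * (starRingEnd ℂ) (kloosterman m n))) := by
      have := Complex.mul_conj' (kloosterman m n)
      push_cast
      linear_combination (-(‖kloosterman m n‖ : ℂ) ^ 2 -
        kloosterman m n * (starRingEnd ℂ) (kloosterman m n)) * this
    rw [h1]
    unfold kloosterman
    rw [map_sum, Finset.sum_mul_sum, ← Finset.sum_product', Finset.sum_mul_sum,
      ← Finset.sum_product', Finset.sum_mul_sum, ← Finset.sum_product']
    refine Finset.sum_congr rfl fun t _ => ?_
    simp only [← AddChar.map_neg_eq_conj, ← AddChar.map_add_eq_mul]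
    congr 1
    simp only [hA, hB]
    ring
  have hprim := ZMod.isPrimitive_stdAddChar q
  have : ((∑ m : ZMod q, ∑ n : ZMod q, ‖kloosterman m n‖ ^ 4 : ℝ) : ℂ) =
      (((q : ℝ) ^ 2 * (energySet q).card : ℝ) : ℂ) := by
    push_cast
    have hpow' := fun m n => (hpow m n)
    push_cast at hpow'
    simp_rw [hpow']
    calc ∑ m : ZMod q, ∑ n : ZMod q, ∑ t,
          (ZMod.stdAddChar (m * A t) * ZMod.stdAddChar (n * B t) : ℂ)
        = ∑ m : ZMod q, ∑ t, ∑ n : ZMod q,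
          (ZMod.stdAddChar (m * A t) * ZMod.stdAddChar (n * B t) : ℂ) :=
          Finset.sum_congr rfl fun m _ => Finset.sum_comm
      _ = ∑ t, ∑ m : ZMod q, ∑ n : ZMod q,
          (ZMod.stdAddChar (m * A t) * ZMod.stdAddChar (n * B t) : ℂ) := Finset.sum_comm
      _ = ∑ t, (if A t = 0 ∧ B t = 0 then (q : ℂ) ^ 2 else 0) := by
          refine Finset.sum_congr rfl fun t _ => ?_
          rw [← Finset.sum_mul_sum, AddChar.sum_mulShift _ hprim, AddChar.sum_mulShift _ hprim]
          by_cases h1 : A t = 0 <;> by_cases h2 : B t = 0 <;> simp [h1, h2, ZMod.card, sq]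
      _ = (q : ℂ) ^ 2 * (energySet q).card := by
          rw [← Finset.sum_filter, Finset.sum_const, nsmul_eq_mul, mul_comm]
          rfl
  exact_mod_cast this

/-- Put `x = u₁ - u₃` and `y = u₁ - u₄`. Eliminating `u₂` and clearing denominators gives `2 x y u₁
= (x + y) x y`. For given `x, y` the solutions `u₁` lie in a coset of the annihilator of `2 x y`,
and `(x, y, u₁)` determines the quadruple. -/
lemma card_energySet_le : (energySet q).card ≤ 2 * (q * q.divisors.card) ^ 2 := by
  classical
  set S : Finset ((_ : ZMod q × ZMod q) × ZMod q) := Finset.univ.sigma fun p =>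
    Finset.univ.filter fun z : ZMod q => 2 * (p.1 * p.2) * z = (p.1 + p.2) * (p.1 * p.2)
  have h1 : (energySet q).card ≤ S.card := by
    apply Finset.card_le_card_of_injOn
      (fun t => ⟨((t.1 : ZMod q) - t.2.2.1, (t.1 : ZMod q) - t.2.2.2), (t.1 : ZMod q)⟩)
    · rintro ⟨a, b, c, d⟩ ht
      simp only [energySet, Finset.coe_filter, Finset.mem_univ, true_and, mem_ofPred_eq] at ht
      simp only [S, Finset.coe_sigma, Finset.mem_coe, mem_sigma_iff, Finset.coe_univ, mem_univ,
        true_and, Finset.mem_filter, Finset.mem_univ]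
      obtain ⟨h1, h2⟩ := ht
      have ha := a.mul_inv
      have hb := b.mul_inv
      have hc := c.mul_inv
      have hd := d.mul_inv
      set a' := ((a⁻¹ : (ZMod q)ˣ) : ZMod q)
      set b' := ((b⁻¹ : (ZMod q)ˣ) : ZMod q)
      set c' := ((c⁻¹ : (ZMod q)ˣ) : ZMod q)
      set d' := ((d⁻¹ : (ZMod q)ˣ) : ZMod q)
      generalize (a : ZMod q) = a at *
      generalize (b : ZMod q) = b at *
      generalize (c : ZMod q) = c at *
      generalize (d : ZMod q) = d at *
      have h3 : (a + b) * (c * d) = (c + d) * (a * b) := by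
        have e1 : (a' + b') * (a * b * c * d) = (a + b) * (c * d) := by
          linear_combination (b * c * d) * ha + (a * c * d) * hb
        have e2 : (c' + d') * (a * b * c * d) = (c + d) * (a * b) := by
          linear_combination (a * b * d) * hc + (a * b * c) * hd
        rw [← e1, ← e2]
        linear_combination (a * b * c * d) * h2
      have hb' : b = c + d - a := by linear_combination h1
      subst hb'
      linear_combination h3
    · rintro ⟨a, b, c, d⟩ ht ⟨a', b', c', d'⟩ ht' h
      simp only [energySet, Finset.coe_filter, Finset.mem_univ, true_and, mem_ofPred_eq] at ht ht'
      simp only [Sigma.mk.injEq, Prod.mk.injEq, heq_eq_eq] at h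
      obtain ⟨⟨h1, h2⟩, h3⟩ := h
      have hc : (c : ZMod q) = c' := by linear_combination h3 - h1
      have hd : (d : ZMod q) = d' := by linear_combination h3 - h2
      have hb : (b : ZMod q) = b' := by linear_combination ht.1 - ht'.1 + hc + hd - h3
      simp only [Prod.mk.injEq]
      exact ⟨Units.ext h3, Units.ext hb, Units.ext hc, Units.ext hd⟩
  have h2 : ∀ p : ZMod q × ZMod q,
      (Finset.univ.filter fun z : ZMod q =>
        2 * (p.1 * p.2) * z = (p.1 + p.2) * (p.1 * p.2)).card ≤
      2 * (annCard p.1 * annCard p.2) := by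
    intro p
    have h3 : (Finset.univ.filter fun z : ZMod q =>
        2 * (p.1 * p.2) * z = (p.1 + p.2) * (p.1 * p.2)).card ≤ annCard (2 * (p.1 * p.2)) := by
      rcases Finset.eq_empty_or_nonempty (Finset.univ.filter fun z : ZMod q =>
        2 * (p.1 * p.2) * z = (p.1 + p.2) * (p.1 * p.2)) with h | ⟨z₀, hz₀⟩
      · rw [h]; simp
      · apply Finset.card_le_card_of_injOn (fun z => z - z₀)
        · intro z hz
          simp only [Finset.coe_filter, Finset.mem_filter, Finset.mem_univ, true_and,
            mem_ofPred_eq] at hz hz₀ ⊢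
          rw [mul_sub, hz, hz₀, sub_self]
        · intro z _ w _ h
          simpa using h
    have h4 : annCard (2 : ZMod q) ≤ 2 := by
      simpa using annCard_natCast_le (q := q) (n := 2) (by norm_num)
    exact (h3.trans (annCard_mul_le _ _)).trans (Nat.mul_le_mul h4 (annCard_mul_le _ _))
  calc (energySet q).card ≤ S.card := h1
    _ = ∑ p : ZMod q × ZMod q, _ := Finset.card_sigma _ _
    _ ≤ ∑ p : ZMod q × ZMod q, 2 * (annCard p.1 * annCard p.2) :=
        Finset.sum_le_sum fun p _ => h2 p
    _ = 2 * (∑ x : ZMod q, annCard x) ^ 2 := by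
        rw [← Finset.mul_sum, sq, Finset.sum_mul_sum, ← Finset.univ_product_univ,
          Finset.sum_product]
    _ ≤ _ := Nat.mul_le_mul_left _ (Nat.pow_le_pow_left sum_annCard_le 2)

/-- Kloosterman's bound, from the fourth moment. -/
lemma norm_kloosterman_pow_four_le (m : ZMod q) {n : ℤ} (hn : n ≠ 0) :
    (Nat.totient q : ℝ) * ‖kloosterman m (n : ZMod q)‖ ^ 4 ≤
      n.natAbs * ((q : ℝ) ^ 2 * (2 * (q * q.divisors.card) ^ 2)) := by
  classical
  set f : ZMod q × ZMod q → ℝ := fun p => ‖kloosterman p.1 p.2‖ ^ 4 with hf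
  set g : (ZMod q)ˣ → ZMod q × ZMod q := fun u =>
    (m * (u : ZMod q), (n : ZMod q) * ((u⁻¹ : (ZMod q)ˣ) : ZMod q)) with hg
  -- The second coordinate fixes `n u⁻¹`, hence `u⁻¹` up to the annihilator of `n`, which has at
  -- most `|n|` elements.
  have hfib : ∀ p, ((Finset.univ.filter fun u => g u = p).card : ℝ) ≤ n.natAbs := by
    intro p
    have : (Finset.univ.filter fun u => g u = p).card ≤ annCard (n : ZMod q) := by
      rcases Finset.eq_empty_or_nonempty (Finset.univ.filter fun u => g u = p) with h | ⟨u₀, hu₀⟩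
      · rw [h]; simp
      · apply Finset.card_le_card_of_injOn
          (fun u => ((u⁻¹ : (ZMod q)ˣ) : ZMod q) - ((u₀⁻¹ : (ZMod q)ˣ) : ZMod q))
        · intro u hu
          simp only [Finset.coe_filter, Finset.mem_filter, Finset.mem_univ, true_and,
            mem_ofPred_eq] at hu hu₀ ⊢
          have := congrArg Prod.snd (hu.trans hu₀.symm)
          simp only [hg] at this
          rw [mul_sub, this, sub_self]
        · intro u _ w _ h
          have h' := sub_left_inj.1 h
          exact inv_injective (Units.ext h')
    exact_mod_cast this.trans (annCard_intCast_le hn)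
  have h1 : (Nat.totient q : ℝ) * ‖kloosterman m (n : ZMod q)‖ ^ 4 =
      ∑ u : (ZMod q)ˣ, f (g u) := by
    simp only [hf, hg, kloosterman_mul_unit, Finset.sum_const, Finset.card_univ,
      ZMod.card_units_eq_totient, nsmul_eq_mul]
  have h2 : ∑ u : (ZMod q)ˣ, f (g u) ≤ n.natAbs * ∑ p, f p := by
    rw [← Finset.sum_fiberwise Finset.univ g (fun u => f (g u)), Finset.mul_sum]
    refine Finset.sum_le_sum fun p _ => ?_
    calc ∑ u ∈ Finset.univ.filter (fun u => g u = p), f (g u)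
        = ∑ u ∈ Finset.univ.filter (fun u => g u = p), f p :=
          Finset.sum_congr rfl fun u hu => by rw [(Finset.mem_filter.1 hu).2]
      _ = ((Finset.univ.filter fun u => g u = p).card : ℝ) * f p := by
          rw [Finset.sum_const, nsmul_eq_mul]
      _ ≤ _ := mul_le_mul_of_nonneg_right (hfib p) (by positivity)
  have h3 : ∑ p, f p = (q : ℝ) ^ 2 * (energySet q).card := by
    rw [← sum_norm_kloosterman_pow_four, ← Finset.univ_product_univ, Finset.sum_product]
  rw [h1]
  refine h2.trans ?_
  rw [h3]
  have h4 : ((energySet q).card : ℝ) ≤ 2 * (q * q.divisors.card) ^ 2 := by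
    exact_mod_cast card_energySet_le (q := q)
  gcongr

end Kloosterman

/-! ### Divisor and totient bounds -/

section DivisorBound

lemma le_totient_mul_card_divisors (n : ℕ) : n ≤ n.totient * n.divisors.card := by
  rcases Nat.eq_zero_or_pos n with rfl | hn
  · simp
  calc n = ∑ d ∈ n.divisors, d.totient := (Nat.sum_totient n).symm
    _ ≤ ∑ d ∈ n.divisors, n.totient := Finset.sum_le_sum fun d hd =>
        Nat.le_of_dvd (Nat.totient_pos.2 hn)
          (Nat.totient_dvd_of_dvd (Nat.dvd_of_mem_divisors hd))
    _ = _ := by rw [Finset.sum_const, smul_eq_mul, mul_comm]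

lemma exists_succ_pow_le_mul_two_pow (K : ℕ) :
    ∃ M : ℕ, 1 ≤ M ∧ ∀ k : ℕ, (k + 1) ^ K ≤ M * 2 ^ k := by
  have h := tendsto_pow_const_div_const_pow_of_one_lt K (r := (2 : ℝ)) (by norm_num)
  obtain ⟨B, hB⟩ := h.bddAbove_range
  obtain ⟨M, hM⟩ := exists_nat_ge (max (2 * B) 1)
  refine ⟨M, by exact_mod_cast (le_max_right _ _).trans hM, fun k => ?_⟩
  have h1 : ((k + 1 : ℕ) : ℝ) ^ K / 2 ^ (k + 1) ≤ B := hB ⟨k + 1, rfl⟩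
  rw [div_le_iff₀ (by positivity)] at h1
  have h2 : 2 * B ≤ M := (le_max_left _ _).trans hM
  have : ((k + 1 : ℕ) : ℝ) ^ K ≤ M * 2 ^ k := by
    calc _ ≤ B * 2 ^ (k + 1) := h1
      _ = (2 * B) * 2 ^ k := by ring
      _ ≤ _ := by gcongr
  exact_mod_cast this

/-- The divisor bound: `τ(n) ^ K ≪ n` for each fixed `K`. -/
lemma exists_card_divisors_pow_le (K : ℕ) :
    ∃ C : ℕ, ∀ n : ℕ, n ≠ 0 → n.divisors.card ^ K ≤ C * n := by
  obtain ⟨M, hM1, hM⟩ := exists_succ_pow_le_mul_two_pow K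
  refine ⟨M ^ (2 ^ K), fun n hn => ?_⟩
  -- For `p ≥ 2 ^ K`, `(e + 1) ^ K ≤ 2 ^ (e K) ≤ p ^ e` with no loss. Fewer than `2 ^ K` primes
  -- remain, and each costs at most a factor `M`.
  have hterm : ∀ p ∈ n.primeFactors, (n.factorization p + 1) ^ K ≤
      (if p < 2 ^ K then M else 1) * p ^ n.factorization p := by
    intro p hp
    have hp2 : 2 ≤ p := (Nat.prime_of_mem_primeFactors hp).two_le
    split_ifs with h
    · exact (hM _).trans (Nat.mul_le_mul_left _ (Nat.pow_le_pow_left hp2 _))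
    · rw [one_mul]
      calc (n.factorization p + 1) ^ K ≤ (2 ^ n.factorization p) ^ K :=
            Nat.pow_le_pow_left (Nat.lt_two_pow_self) _
        _ = (2 ^ K) ^ n.factorization p := by rw [← pow_mul, ← pow_mul, mul_comm]
        _ ≤ _ := Nat.pow_le_pow_left (not_lt.1 h) _
  rw [Nat.card_divisors hn, ← Finset.prod_pow]
  calc ∏ p ∈ n.primeFactors, (n.factorization p + 1) ^ K
      ≤ ∏ p ∈ n.primeFactors, (if p < 2 ^ K then M else 1) * p ^ n.factorization p :=
        Finset.prod_le_prod' hterm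
    _ = (∏ p ∈ n.primeFactors, if p < 2 ^ K then M else 1) * n := by
        rw [Finset.prod_mul_distrib]
        congr 1
        exact Nat.prod_factorization_pow_eq_self hn
    _ ≤ M ^ (2 ^ K) * n := by
        apply Nat.mul_le_mul_right
        rw [Finset.prod_ite, Finset.prod_const, Finset.prod_const_one, mul_one]
        apply Nat.pow_le_pow_right hM1
        calc _ ≤ (Finset.range (2 ^ K)).card := Finset.card_le_card (by
              intro p hp; simpa using (Finset.mem_filter.1 hp).2)
          _ = _ := Finset.card_range _

end DivisorBound

/-- The moment bound reads `φ |K|⁴ ≤ 2 |n| q⁴ τ²`. With `q ≤ φ τ` it gives `|K / φ|⁴ ≤ 2 |n| τ⁷ /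
q`, which tends to `0` because `τ` is smaller than any power of `q`. -/
lemma tendsto_kloosterman_div_totient {m n : ℤ} (h : m ≠ 0 ∨ n ≠ 0) :
    Tendsto (fun q : ℕ => kloosterman ((m : ℤ) : ZMod (q + 1)) ((n : ℤ) : ZMod (q + 1)) /
      ((q + 1).totient : ℂ)) atTop (𝓝 0) := by
  wlog hn : n ≠ 0 generalizing m n
  · simp_rw [fun q : ℕ => kloosterman_comm ((m : ℤ) : ZMod (q + 1)) ((n : ℤ) : ZMod (q + 1))]
    exact this h.symm (h.resolve_right hn)
  -- The exponent `14 = 2 · 7` makes `τ⁷ ≪ √q`, which leaves a saving of `√q`.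
  obtain ⟨C, hC⟩ := exists_card_divisors_pow_le 14
  set B : ℝ := n.natAbs * 2 * Real.sqrt C
  have hbound : ∀ q : ℕ, ‖kloosterman ((m : ℤ) : ZMod (q + 1)) ((n : ℤ) : ZMod (q + 1)) /
      ((q + 1).totient : ℂ)‖ ^ 4 ≤ B * (1 / Real.sqrt ((q : ℝ) + 1)) := by
    intro q
    have h1 := norm_kloosterman_pow_four_le (q := q + 1) (m : ZMod (q + 1)) hn
    set k := ‖kloosterman ((m : ℤ) : ZMod (q + 1)) ((n : ℤ) : ZMod (q + 1))‖
    have hφ : (0 : ℝ) < (q + 1).totient := by exact_mod_cast Nat.totient_pos.2 q.succ_pos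
    have h2 : ((q + 1 : ℕ) : ℝ) ≤ ((q + 1).totient : ℝ) * (q + 1).divisors.card := by
      exact_mod_cast le_totient_mul_card_divisors (q + 1)
    set φ : ℝ := ((q + 1).totient : ℝ)
    have h3 : ((q + 1).divisors.card : ℝ) ^ 14 ≤ C * ((q + 1 : ℕ) : ℝ) := by
      exact_mod_cast hC (q + 1) q.succ_ne_zero
    have hq0 : (0 : ℝ) < ((q + 1 : ℕ) : ℝ) := by positivity
    rw [show (q : ℝ) + 1 = ((q + 1 : ℕ) : ℝ) by push_cast; ring]
    set x : ℝ := ((q + 1 : ℕ) : ℝ)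
    set τ : ℝ := ((q + 1).divisors.card : ℝ)
    have hτ : 0 ≤ τ := by positivity
    have h4 : τ ^ 7 ≤ Real.sqrt C * Real.sqrt x := by
      rw [← Real.sqrt_mul (by positivity)]
      apply Real.le_sqrt_of_sq_le
      rw [← pow_mul]; exact h3
    rw [norm_div, div_pow, Complex.norm_natCast, div_le_iff₀ (by positivity)]
    have hx5 : x ^ 5 ≤ φ ^ 5 * τ ^ 5 := by
      rw [← mul_pow]; exact pow_le_pow_left₀ hq0.le h2 5
    have hs : Real.sqrt x * Real.sqrt x = x := Real.mul_self_sqrt hq0.le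
    have hsx : 0 < Real.sqrt x := Real.sqrt_pos.2 hq0
    have key : φ * k ^ 4 * x ≤ (B * (1 / Real.sqrt x) * φ ^ 4) * φ * x := by
      calc φ * k ^ 4 * x ≤ (n.natAbs * (x ^ 2 * (2 * (x * τ) ^ 2))) * x := by gcongr
        _ = n.natAbs * 2 * τ ^ 2 * x ^ 5 := by ring
        _ ≤ n.natAbs * 2 * τ ^ 2 * (φ ^ 5 * τ ^ 5) := by gcongr
        _ = n.natAbs * 2 * φ ^ 5 * τ ^ 7 := by ring
        _ ≤ n.natAbs * 2 * φ ^ 5 * (Real.sqrt C * Real.sqrt x) := by gcongr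
        _ = _ := by
          simp only [B]
          field_simp
          rw [Real.sq_sqrt hq0.le]
    have := le_of_mul_le_mul_right key hq0
    nlinarith [this, hφ]
  have h0 : Tendsto (fun q : ℕ => B * (1 / Real.sqrt ((q : ℝ) + 1))) atTop (𝓝 0) := by
    have : Tendsto (fun q : ℕ => 1 / Real.sqrt ((q : ℝ) + 1)) atTop (𝓝 0) := by
      simp_rw [one_div]
      exact tendsto_inv_atTop_zero.comp (Real.tendsto_sqrt_atTop.comp
        (tendsto_atTop_add_const_right _ _ tendsto_natCast_atTop_atTop))
    simpa using this.const_mul B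
  have h4 := squeeze_zero (fun q => by positivity) hbound h0
  rw [tendsto_zero_iff_norm_tendsto_zero]
  have h5 := h4.sqrt.sqrt
  simp only [Real.sqrt_zero] at h5
  refine h5.congr fun q => ?_
  rw [show ∀ y : ℝ, y ^ 4 = (y ^ 2) ^ 2 from fun y => by ring, Real.sqrt_sq (by positivity),
    Real.sqrt_sq (by positivity)]

/-! ### Equidistribution of units and their inverses on the torus -/

section Equidistribution

/-- The Haar probability measure on the two-dimensional torus. -/
def torusMeasure : Measure (UnitAddTorus (Fin 2)) := Measure.pi fun _ => volume

instance : IsProbabilityMeasure (volume : Measure UnitAddCircle) :=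
  ⟨UnitAddCircle.measure_univ⟩

instance : IsProbabilityMeasure torusMeasure := by
  unfold torusMeasure; infer_instance

lemma integral_fourier_eq_zero {n : ℤ} (hn : n ≠ 0) :
    ∫ x : UnitAddCircle, (fourier n x : ℂ) = 0 :=
  integral_eq_zero_of_add_right_eq_neg (fourier_add_half_inv_index hn (by norm_num))

lemma integral_mFourier_torus {k : Fin 2 → ℤ} (hk : k ≠ 0) :
    ∫ x, UnitAddTorus.mFourier k x ∂torusMeasure = 0 := by
  simp only [UnitAddTorus.mFourier, ContinuousMap.coe_mk, torusMeasure]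
  rw [integral_fintype_prod_eq_prod (fun i (x : UnitAddCircle) => (fourier (k i) x : ℂ))]
  obtain ⟨i, hi⟩ := Function.ne_iff.1 hk
  exact Finset.prod_eq_zero (Finset.mem_univ i) (integral_fourier_eq_zero hi)

/-- The point `(u / q, -u⁻¹ / q)` of the torus. -/
def inversePoint {q : ℕ} [NeZero q] (u : (ZMod q)ˣ) : UnitAddTorus (Fin 2) :=
  ![ZMod.toAddCircle (u : ZMod q), ZMod.toAddCircle (-((u⁻¹ : (ZMod q)ˣ) : ZMod q))]

/-- The uniform probability measure on the points `(u / q, -u⁻¹ / q)`. -/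
def inverseMeasure (q : ℕ) [NeZero q] : Measure (UnitAddTorus (Fin 2)) :=
  ((Fintype.card (ZMod q)ˣ : ENNReal))⁻¹ • ∑ u : (ZMod q)ˣ, Measure.dirac (inversePoint u)

instance (q : ℕ) [NeZero q] : IsProbabilityMeasure (inverseMeasure q) := by
  constructor
  simp only [inverseMeasure, Measure.smul_apply, Measure.coe_finsetSum, Finset.sum_apply,
    measure_univ, Finset.sum_const, Finset.card_univ, nsmul_eq_mul, mul_one, smul_eq_mul]
  exact ENNReal.inv_mul_cancel (by simp [NeZero.ne q]) (by simp)

lemma inverseMeasure_real (q : ℕ) [NeZero q] (A : Set (UnitAddTorus (Fin 2))) :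
    (inverseMeasure q A).toReal =
      (({u : (ZMod q)ˣ | inversePoint u ∈ A}.ncard : ℕ) : ℝ) / (q.totient : ℝ) := by
  classical
  simp only [inverseMeasure, Measure.smul_apply, Measure.coe_finsetSum, Finset.sum_apply,
    smul_eq_mul, Measure.dirac_apply, indicator_apply, Pi.one_apply, Finset.sum_boole,
    ENNReal.toReal_mul, ENNReal.toReal_inv, ENNReal.toReal_natCast, ZMod.card_units_eq_totient]
  rw [div_eq_inv_mul, Set.ncard_eq_toFinset_card']
  simp

lemma integral_inverseMeasure (q : ℕ) [NeZero q] (f : UnitAddTorus (Fin 2) → ℂ)  :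
    ∫ x, f x ∂(inverseMeasure q) = (q.totient : ℂ)⁻¹ * ∑ u : (ZMod q)ˣ, f (inversePoint u) := by
  rw [inverseMeasure, integral_smul_measure, integral_finsetSum_measure]
  · simp [integral_dirac, ZMod.card_units_eq_totient]
  · intro u _
    exact integrable_dirac (by simp)

lemma integral_mFourier_inverseMeasure (q : ℕ) [NeZero q] (k : Fin 2 → ℤ) :
    ∫ x, UnitAddTorus.mFourier k x ∂(inverseMeasure q) =
      kloosterman ((k 0 : ℤ) : ZMod q) ((-k 1 : ℤ) : ZMod q) / (q.totient : ℂ) := by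
  rw [integral_inverseMeasure, div_eq_inv_mul, kloosterman]
  congr 1
  refine Finset.sum_congr rfl fun u _ => ?_
  simp only [UnitAddTorus.mFourier, ContinuousMap.coe_mk, Fin.prod_univ_two, inversePoint,
    Matrix.cons_val_zero, Matrix.cons_val_one, fourier_apply, AddChar.map_add_eq_mul,
    ZMod.stdAddChar_apply, ZMod.toCircle]
  simp only [AddChar.coe_compAddMonoidHom, Function.comp_apply]
  congr 3
  · rw [← zsmul_eq_mul, map_zsmul]; rfl
  · rw [← map_zsmul]
    simp only [zsmul_eq_mul, mul_neg, Int.cast_neg, neg_mul]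
    rfl

lemma tendsto_integral_mFourier (k : Fin 2 → ℤ) :
    Tendsto (fun q : ℕ => ∫ x, UnitAddTorus.mFourier k x ∂(inverseMeasure (q + 1))) atTop
      (𝓝 (∫ x, UnitAddTorus.mFourier k x ∂torusMeasure)) := by
  rcases eq_or_ne k 0 with rfl | hk
  · simp [UnitAddTorus.mFourier_zero]
  · rw [integral_mFourier_torus hk]
    simp_rw [integral_mFourier_inverseMeasure]
    apply tendsto_kloosterman_div_totient
    by_contra! h
    exact hk (by ext i; fin_cases i <;> simp_all)

/-- Weyl's criterion: the points `(u / q, -u⁻¹ / q)` are equidistributed as `q → ∞`. -/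
lemma tendsto_integral_inverseMeasure (f : C(UnitAddTorus (Fin 2), ℂ)) :
    Tendsto (fun q : ℕ => ∫ x, f x ∂(inverseMeasure (q + 1))) atTop
      (𝓝 (∫ x, f x ∂torusMeasure)) := by
  have hint : ∀ (g : C(UnitAddTorus (Fin 2), ℂ)) (μ : Measure (UnitAddTorus (Fin 2)))
      [IsProbabilityMeasure μ], Integrable g μ := fun g μ _ =>
    BoundedContinuousFunction.integrable μ (BoundedContinuousFunction.mkOfCompact g)
  have hspan : ∀ g ∈ Submodule.span ℂ (range (UnitAddTorus.mFourier (d := Fin 2))),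
      Tendsto (fun q : ℕ => ∫ x, g x ∂(inverseMeasure (q + 1))) atTop
      (𝓝 (∫ x, g x ∂torusMeasure)) := by
    intro g hg
    induction hg using Submodule.span_induction with
    | mem g hg => obtain ⟨k, rfl⟩ := hg; exact tendsto_integral_mFourier k
    | zero => simp
    | add g h _ _ hg hh =>
      simp only [ContinuousMap.coe_add, Pi.add_apply]
      rw [integral_add (hint g _) (hint h _)]
      refine (hg.add hh).congr fun q => ?_
      rw [integral_add (hint g _) (hint h _)]
    | smul c g _ hg =>
      simp only [ContinuousMap.coe_smul, Pi.smul_apply]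
      simp_rw [integral_smul]
      exact hg.const_smul c
  have hdense : f ∈ (Submodule.span ℂ (range (UnitAddTorus.mFourier (d := Fin 2)))
      ).topologicalClosure := by
    rw [UnitAddTorus.span_mFourier_closure_eq_top]; trivial
  rw [Metric.tendsto_atTop]
  intro ε hε
  obtain ⟨g, hg, hfg⟩ := Metric.mem_closure_iff.1 hdense (ε / 3) (by positivity)
  obtain ⟨N, hN⟩ := Metric.tendsto_atTop.1 (hspan g hg) (ε / 3) (by positivity)
  have hclose : ∀ (μ : Measure (UnitAddTorus (Fin 2))) [IsProbabilityMeasure μ],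
      dist (∫ x, f x ∂μ) (∫ x, g x ∂μ) < ε / 3 := by
    intro μ _
    rw [dist_eq_norm, ← integral_sub (hint f _) (hint g _)]
    have := norm_integral_le_of_norm_le_const (μ := μ) (f := fun x => f x - g x)
      (C := dist f g) (ae_of_all _ fun x => by
        rw [← dist_eq_norm]; exact ContinuousMap.dist_apply_le_dist x)
    simp only [probReal_univ, mul_one] at this
    exact this.trans_lt hfg
  refine ⟨N, fun q hq => ?_⟩
  have h1 := hclose (inverseMeasure (q + 1))
  have h2 := hclose torusMeasure
  rw [dist_comm] at h2
  have := dist_triangle4 (∫ x, f x ∂(inverseMeasure (q + 1)))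
    (∫ x, g x ∂(inverseMeasure (q + 1))) (∫ x, g x ∂torusMeasure) (∫ x, f x ∂torusMeasure)
  linarith [hN q hq]

/-- Convergence against continuous functions is weak convergence, and the portmanteau theorem passes
to sets with null frontier. -/
lemma tendsto_card_inversePoint_mem {A : Set (UnitAddTorus (Fin 2))}
    (hA : torusMeasure (frontier A) = 0) :
    Tendsto (fun q : ℕ => (({u : (ZMod (q + 1))ˣ | inversePoint u ∈ A}.ncard : ℕ) : ℝ) /
      ((q + 1).totient : ℝ)) atTop (𝓝 (torusMeasure A).toReal) := by
  set μs : ℕ → ProbabilityMeasure (UnitAddTorus (Fin 2)) := fun q =>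
    ⟨inverseMeasure (q + 1), inferInstance⟩
  set μ : ProbabilityMeasure (UnitAddTorus (Fin 2)) := ⟨torusMeasure, inferInstance⟩
  have hlim : Tendsto μs atTop (𝓝 μ) := by
    rw [ProbabilityMeasure.tendsto_iff_forall_integral_rclike_tendsto ℂ]
    intro f
    exact tendsto_integral_inverseMeasure f.toContinuousMap
  have : Tendsto (fun q : ℕ => inverseMeasure (q + 1) A) atTop (𝓝 (torusMeasure A)) :=
    ProbabilityMeasure.tendsto_measure_of_null_frontier_of_tendsto' hlim hA
  have h := (ENNReal.tendsto_toReal (measure_ne_top torusMeasure A)).comp this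
  refine h.congr fun q => ?_
  exact inverseMeasure_real (q + 1) A

/-- The arc `[0, c)` of the circle. -/
def arc (c : ℝ) : Set UnitAddCircle := (fun x : ℝ => (x : UnitAddCircle)) '' Ico 0 c

lemma coe_mem_arc {c : ℝ} (hc : c ≤ 1) {x : ℝ} (hx : x ∈ Ico (0 : ℝ) 1) :
    (x : UnitAddCircle) ∈ arc c ↔ x < c := by
  constructor
  · rintro ⟨y, hy, hxy⟩
    have := (AddCircle.coe_eq_coe_iff_of_mem_Ico (p := (1 : ℝ)) (a := 0)
      (by simpa using ⟨hy.1, hy.2.trans_le hc⟩) (by simpa using hx)).1 hxy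
    rw [← this]; exact hy.2
  · intro h
    exact ⟨x, ⟨hx.1, h⟩, rfl⟩

lemma volume_singleton_circle (x : UnitAddCircle) : volume ({x} : Set UnitAddCircle) = 0 := by
  rw [← (UnitAddCircle.measurePreserving_mk 0).measure_preimage
    (measurableSet_singleton x).nullMeasurableSet, Measure.restrict_apply' measurableSet_Ioc]
  apply Set.Subsingleton.measure_zero
  rintro y ⟨hy, hy1⟩ z ⟨hz, hz1⟩
  exact (AddCircle.coe_eq_coe_iff_of_mem_Ioc (p := (1 : ℝ)) (a := 0) hy1 hz1).1
    (Eq.trans hy (Eq.symm hz))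

lemma volume_frontier_arc (c : ℝ) : volume (frontier (arc c)) = 0 := by
  have h1 : closure (arc c) ⊆ (fun x : ℝ => (x : UnitAddCircle)) '' Icc 0 c := by
    apply closure_minimal (image_mono Ico_subset_Icc_self)
    exact (isCompact_Icc.image (AddCircle.continuous_mk' (1 : ℝ))).isClosed
  have h2 : (fun x : ℝ => (x : UnitAddCircle)) '' Ioo 0 c ⊆ interior (arc c) := by
    apply interior_maximal (image_mono Ioo_subset_Ico_self)
    exact QuotientAddGroup.isOpenMap_coe _ isOpen_Ioo
  have h3 : frontier (arc c) ⊆ {((0 : ℝ) : UnitAddCircle)} ∪ {(c : UnitAddCircle)} := by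
    intro x hx
    obtain ⟨y, hy, rfl⟩ := h1 hx.1
    by_cases h0 : y = 0
    · left; simp [h0]
    by_cases hc : y = c
    · right; simp [hc]
    exact absurd (h2 ⟨y, ⟨lt_of_le_of_ne hy.1 (Ne.symm h0), lt_of_le_of_ne hy.2 hc⟩, rfl⟩) hx.2
  exact measure_mono_null h3 (measure_union_null (volume_singleton_circle _)
    (volume_singleton_circle _))

lemma volume_arc {c : ℝ} (hc : c ≤ 1) : volume (arc c) = ENNReal.ofReal c := by
  have hmeas : NullMeasurableSet (arc c) :=
    nullMeasurableSet_of_null_frontier (volume_frontier_arc c)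
  rw [← (UnitAddCircle.measurePreserving_mk 0).measure_preimage hmeas,
    Measure.restrict_apply' measurableSet_Ioc, zero_add]
  apply le_antisymm
  · calc _ ≤ volume (Ioo 0 c ∪ {1}) := by
          apply measure_mono
          rintro x ⟨hx, hx1⟩
          rcases hx1.2.lt_or_eq with h | h
          · left; exact ⟨hx1.1, (coe_mem_arc hc ⟨hx1.1.le, h⟩).1 hx⟩
          · right; exact h
      _ ≤ volume (Ioo 0 c) + volume {(1 : ℝ)} := measure_union_le _ _
      _ = _ := by simp
  · calc ENNReal.ofReal c = volume (Ioo 0 c) := by simp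
      _ ≤ _ := by
          apply measure_mono
          intro x hx
          exact ⟨(coe_mem_arc hc ⟨hx.1.le, hx.2.trans_le hc⟩).2 hx.2, hx.1, (hx.2.trans_le hc).le⟩

lemma tendsto_card_mem_arc {D : Set UnitAddCircle} (hD : volume (frontier D) = 0)
    {c : ℝ} (hc0 : 0 ≤ c) (hc : c ≤ 1) :
    Tendsto (fun q : ℕ => (({u : (ZMod (q + 1))ˣ | ZMod.toAddCircle (u : ZMod (q + 1)) ∈ arc c ∧
      ZMod.toAddCircle (-((u⁻¹ : (ZMod (q + 1))ˣ) : ZMod (q + 1))) ∈ D}.ncard : ℕ) : ℝ) /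
      ((q + 1).totient : ℝ)) atTop (𝓝 (c * (volume D).toReal)) := by
  set A : Set (UnitAddTorus (Fin 2)) := Set.pi univ ![arc c, D] with hAdef
  have hA' : A = (Function.eval 0 : UnitAddTorus (Fin 2) → UnitAddCircle) ⁻¹' arc c ∩
      (Function.eval 1 : UnitAddTorus (Fin 2) → UnitAddCircle) ⁻¹' D := by
    ext x; simp [A, Fin.forall_fin_two]
  have hfr : ∀ (i : Fin 2) (s : Set UnitAddCircle), volume (frontier s) = 0 →
      torusMeasure (frontier ((Function.eval i : UnitAddTorus (Fin 2) → UnitAddCircle) ⁻¹' s))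
        = 0 := by
    intro i s hs
    rw [← (isOpenMap_eval i).preimage_frontier_eq_frontier_preimage (continuous_apply i)]
    exact (Measure.quasiMeasurePreserving_eval (fun _ : Fin 2 => (volume : Measure UnitAddCircle))
      i).preimage_null hs
  have hA : torusMeasure (frontier A) = 0 := by
    rw [hA']
    exact null_frontier_inter (hfr 0 _ (volume_frontier_arc c)) (hfr 1 _ hD)
  have hvol : (torusMeasure A).toReal = c * (volume D).toReal := by
    rw [torusMeasure, hAdef, Measure.pi_pi, Fin.prod_univ_two]
    simp [volume_arc hc, hc0]
  rw [← hvol]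
  refine (tendsto_card_inversePoint_mem hA).congr fun q => ?_
  congr 3
  ext u
  simp [hA', inversePoint]

end Equidistribution

/-! ### Counting inverses in intervals, uniformly in the interval -/

section UniformCount

/-- `n` is invertible modulo `q` and the point `-n⁻¹ / q` lies in `D`. -/
def InvMem (D : Set UnitAddCircle) (q : ℕ) [NeZero q] (n : ℕ) : Prop :=
  IsUnit (n : ZMod q) ∧ ZMod.toAddCircle (-(n : ZMod q)⁻¹) ∈ D

open Classical in
/-- The number of `n < N` with `InvMem D q n`. -/
def invCount (D : Set UnitAddCircle) (q : ℕ) [NeZero q] (N : ℕ) : ℕ := Nat.count (InvMem D q) N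

variable {D : Set UnitAddCircle}

/-- `InvMem D q` is periodic modulo `q`, so full periods split off. -/
lemma invCount_add_mul {q : ℕ} [NeZero q] (k N : ℕ) :
    invCount D q (k * q + N) = k * invCount D q q + invCount D q N := by
  classical
  induction k with
  | zero => simp
  | succ k ih =>
    have h : invCount D q (q + (k * q + N)) = invCount D q q + invCount D q (k * q + N) := by
      unfold invCount
      rw [Nat.count_add]
      congr 2
      ext n
      simp [InvMem]
    rw [show (k + 1) * q + N = q + (k * q + N) by ring, h, ih]
    ring

lemma invCount_eq_ncard {q : ℕ} [NeZero q] {N : ℕ} (hN : N ≤ q) :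
    invCount D q N = {u : (ZMod q)ˣ | (u : ZMod q).val < N ∧
      ZMod.toAddCircle (-((u⁻¹ : (ZMod q)ˣ) : ZMod q)) ∈ D}.ncard := by
  classical
  rw [invCount, Nat.count_eq_card_filter_range, ← Set.ncard_coe_finset]
  symm
  refine Set.ncard_congr (fun u _ => (u : ZMod q).val) ?_ ?_ ?_
  · rintro u ⟨hu, hD⟩
    rw [Finset.mem_coe, Finset.mem_filter, Finset.mem_range]
    refine ⟨hu, ?_⟩
    rw [InvMem, ZMod.natCast_zmod_val, ZMod.inv_coe_unit]
    exact ⟨u.isUnit, hD⟩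
  · intro u v _ _ h
    exact Units.ext (ZMod.val_injective q h)
  · intro n hn
    rw [Finset.mem_coe, Finset.mem_filter, Finset.mem_range] at hn
    obtain ⟨hn, ⟨u, hu⟩, hD⟩ := hn
    have hval : (n : ZMod q).val = n := ZMod.val_cast_of_lt (hn.trans_le hN)
    refine ⟨u, ⟨?_, ?_⟩, ?_⟩
    · rw [hu, hval]; exact hn
    · rw [← ZMod.inv_coe_unit, hu]; exact hD
    · rw [hu, hval]

/-- Equidistribution is applied only to the finitely many arcs `[0, j / M)`. Monotonicity in `N`
squeezes every other arc between two neighbouring ones, which makes the estimate uniform in `N`. -/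
lemma exists_abs_invCount_sub_le_of_le (hD : volume (frontier D) = 0) {ε : ℝ} (hε : 0 < ε) :
    ∃ q₀ : ℕ, ∀ q ≥ q₀, ∀ N ≤ q + 1,
      |(invCount D (q + 1) N : ℝ) - (volume D).toReal * (q + 1).totient * (N / (q + 1 : ℕ))| ≤
        ε * (q + 1).totient := by
  obtain ⟨M, hM⟩ := exists_nat_gt (2 / ε)
  have hM0 : (0 : ℝ) < M := (by positivity : (0 : ℝ) < 2 / ε).trans hM
  have hM0' : 0 < M := by exact_mod_cast hM0
  set ρ := (volume D).toReal with hρ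
  have hρ0 : 0 ≤ ρ := ENNReal.toReal_nonneg
  have hρ1 : ρ ≤ 1 := by
    have : volume D ≤ 1 := prob_le_one
    simpa using ENNReal.toReal_mono ENNReal.one_ne_top this
  have hev : ∀ᶠ q : ℕ in atTop, ∀ j ∈ Finset.range (M + 1),
      |(({u : (ZMod (q + 1))ˣ | ZMod.toAddCircle (u : ZMod (q + 1)) ∈ arc ((j : ℝ) / M) ∧
      ZMod.toAddCircle (-((u⁻¹ : (ZMod (q + 1))ˣ) : ZMod (q + 1))) ∈ D}.ncard : ℕ) : ℝ) /
      ((q + 1).totient : ℝ) - (j : ℝ) / M * ρ| < ε / 2 := by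
    rw [Finset.eventually_all]
    intro j hj
    have hj' : (j : ℝ) / M ≤ 1 := by
      rw [div_le_one hM0]; exact_mod_cast Nat.lt_succ_iff.1 (Finset.mem_range.1 hj)
    exact (Metric.tendsto_nhds.1 (tendsto_card_mem_arc hD (by positivity) hj')) (ε / 2)
      (by positivity)
  obtain ⟨q₀, hq₀⟩ := eventually_atTop.1 hev
  refine ⟨q₀, fun q hq N hN => ?_⟩
  have hφ : (0 : ℝ) < (q + 1).totient := by exact_mod_cast Nat.totient_pos.2 q.succ_pos
  rcases Nat.eq_zero_or_pos N with rfl | hN0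
  · simp [invCount]; positivity
  -- The grid index with `j / M ≤ N / (q + 1) ≤ (j + 1) / M`. Subtracting `1` keeps `j < M` even
  -- when `N = q + 1`.
  set j := (N * M - 1) / (q + 1) with hj
  have hNM : 1 ≤ N * M := Nat.mul_pos hN0 hM0'
  have hj1 : j * (q + 1) ≤ N * M := (Nat.div_mul_le_self _ _).trans (Nat.sub_le _ _)
  have hj2 : N * M ≤ (j + 1) * (q + 1) := by
    have := Nat.lt_div_mul_add (a := N * M - 1) (b := q + 1) q.succ_pos
    rw [← hj] at this
    rw [add_mul, one_mul]; omega
  have hjM : j < M := by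
    rw [hj, Nat.div_lt_iff_lt_mul (by omega : 0 < q + 1)]
    have : N * M ≤ M * (q + 1) := by rw [mul_comm]; exact Nat.mul_le_mul_left _ hN
    omega
  have hval : ∀ (i : ℕ), i ≤ M → ∀ u : (ZMod (q + 1))ˣ,
      ZMod.toAddCircle (u : ZMod (q + 1)) ∈ arc ((i : ℝ) / M) ↔
        (u : ZMod (q + 1)).val * M < i * (q + 1) := by
    intro i hi u
    have hi' : (i : ℝ) / M ≤ 1 := by
      rw [div_le_one hM0]; exact_mod_cast hi
    have hq0 : (0 : ℝ) < ((q + 1 : ℕ) : ℝ) := by positivity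
    rw [ZMod.toAddCircle_apply, coe_mem_arc hi', div_lt_div_iff₀ hq0 hM0]
    · exact_mod_cast Iff.rfl
    · refine ⟨by positivity, ?_⟩
      rw [div_lt_one hq0]
      exact_mod_cast ZMod.val_lt _
  have h1 := hq₀ q hq j (Finset.mem_range.2 (by omega))
  have h2 := hq₀ q hq (j + 1) (Finset.mem_range.2 (by omega))
  rw [invCount_eq_ncard hN]
  set T := {u : (ZMod (q + 1))ˣ | (u : ZMod (q + 1)).val < N ∧
      ZMod.toAddCircle (-((u⁻¹ : (ZMod (q + 1))ˣ) : ZMod (q + 1))) ∈ D}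
  set T₁ := {u : (ZMod (q + 1))ˣ | ZMod.toAddCircle (u : ZMod (q + 1)) ∈ arc ((j : ℝ) / M) ∧
      ZMod.toAddCircle (-((u⁻¹ : (ZMod (q + 1))ˣ) : ZMod (q + 1))) ∈ D}
  set T₂ := {u : (ZMod (q + 1))ˣ |
      ZMod.toAddCircle (u : ZMod (q + 1)) ∈ arc (((j + 1 : ℕ) : ℝ) / M) ∧
      ZMod.toAddCircle (-((u⁻¹ : (ZMod (q + 1))ˣ) : ZMod (q + 1))) ∈ D}
  have hT₁ : (T₁.ncard : ℝ) ≤ T.ncard := by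
    refine Nat.cast_le.2 (Set.ncard_le_ncard ?_ (Set.toFinite _))
    rintro u ⟨hu, huD⟩
    rw [hval j hjM.le] at hu
    exact ⟨Nat.lt_of_mul_lt_mul_right (hu.trans_le hj1), huD⟩
  have hT₂ : (T.ncard : ℝ) ≤ T₂.ncard := by
    refine Nat.cast_le.2 (Set.ncard_le_ncard ?_ (Set.toFinite _))
    rintro u ⟨hu, huD⟩
    refine ⟨?_, huD⟩
    rw [hval (j + 1) hjM]
    exact (Nat.mul_lt_mul_of_pos_right hu hM0').trans_le hj2
  have hx1 : (j : ℝ) / M ≤ (N : ℝ) / (q + 1 : ℕ) := by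
    rw [div_le_div_iff₀ hM0 (by positivity)]; exact_mod_cast hj1
  have hx2 : (N : ℝ) / (q + 1 : ℕ) ≤ ((j + 1 : ℕ) : ℝ) / M := by
    rw [div_le_div_iff₀ (by positivity) hM0]; exact_mod_cast hj2
  have hM2 : 1 / (M : ℝ) ≤ ε / 2 := by
    rw [div_le_iff₀ hM0]
    rw [div_lt_iff₀ hε] at hM
    linarith
  have hstep : (((j + 1 : ℕ) : ℝ)) / M = j / M + 1 / M := by push_cast; ring
  rw [hstep] at hx2 h2
  set x := (N : ℝ) / (q + 1 : ℕ)
  set φ : ℝ := ((q + 1).totient : ℝ)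
  have e1 : ((j : ℝ) / M * ρ - ε / 2) * φ ≤ T₁.ncard := by
    rw [← le_div_iff₀ hφ]; linarith [(abs_lt.1 h1).1]
  have e2 : (T₂.ncard : ℝ) ≤ (((j : ℝ) / M + 1 / M) * ρ + ε / 2) * φ := by
    rw [← div_le_iff₀ hφ]; linarith [(abs_lt.1 h2).2]
  have hM3 : 1 / (M : ℝ) * ρ ≤ ε / 2 := (mul_le_of_le_one_right (by positivity) hρ1).trans hM2
  have f1 : x * ρ ≤ (j : ℝ) / M * ρ + 1 / M * ρ := by
    rw [← add_mul]; exact mul_le_mul_of_nonneg_right hx2 hρ0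
  have f2 : (j : ℝ) / M * ρ ≤ x * ρ := mul_le_mul_of_nonneg_right hx1 hρ0
  rw [abs_le]
  constructor
  · have : (x * ρ - ε) * φ ≤ ((j : ℝ) / M * ρ - ε / 2) * φ :=
      mul_le_mul_of_nonneg_right (by linarith) hφ.le
    linarith
  · have : (((j : ℝ) / M + 1 / M) * ρ + ε / 2) * φ ≤ (x * ρ + ε) * φ :=
      mul_le_mul_of_nonneg_right (by linarith) hφ.le
    linarith

/-- In every interval of length at most `q`, the integers `n` with `InvMem D q n` have the expected
frequency, uniformly as `q → ∞`. -/
lemma exists_abs_invCount_sub_invCount_le (hD : volume (frontier D) = 0) {ε : ℝ} (hε : 0 < ε) :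
    ∃ q₀ : ℕ, ∀ q ≥ q₀, ∀ N L : ℕ, L ≤ q + 1 →
      |(invCount D (q + 1) (N + L) : ℝ) - invCount D (q + 1) N -
        (volume D).toReal * (q + 1).totient * (L / (q + 1 : ℕ))| ≤ ε * (q + 1).totient := by
  -- A window that wraps around a period is made of three initial segments, hence `ε / 3`.
  obtain ⟨q₀, h⟩ := exists_abs_invCount_sub_le_of_le hD (ε := ε / 3) (by positivity)
  refine ⟨q₀, fun q hq N L hL => ?_⟩
  have hφ : (0 : ℝ) < (q + 1).totient := by exact_mod_cast Nat.totient_pos.2 q.succ_pos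
  set k := N / (q + 1)
  set r := N % (q + 1)
  have hN : N = k * (q + 1) + r := (Nat.div_add_mod' N (q + 1)).symm
  have hr : r ≤ q + 1 := (Nat.mod_lt _ q.succ_pos).le
  have hkey : (invCount D (q + 1) (N + L) : ℝ) - invCount D (q + 1) N =
      invCount D (q + 1) (r + L) - invCount D (q + 1) r := by
    rw [hN, add_assoc, invCount_add_mul, invCount_add_mul]
    push_cast; ring
  rw [hkey]
  have hr' := h q hq r hr
  set φ : ℝ := ((q + 1).totient : ℝ)
  set ρ := (volume D).toReal
  have hq0 : ((q + 1 : ℕ) : ℝ) ≠ 0 := by positivity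
  rcases le_total (r + L) (q + 1) with hle | hle
  · have h1 := h q hq (r + L) hle
    have e : (((r + L : ℕ) : ℝ) / (q + 1 : ℕ)) = r / (q + 1 : ℕ) + L / (q + 1 : ℕ) := by
      push_cast; ring
    rw [e] at h1
    rw [abs_le] at *
    constructor <;> nlinarith
  -- The window runs past the end of the period: count a full period, plus the initial `m`, minus
  -- the initial `r`.
  · obtain ⟨m, hm⟩ := Nat.exists_eq_add_of_le hle
    have hmq : m ≤ q + 1 := by omega
    have h1 := h q hq m hmq
    have h2 := h q hq (q + 1) le_rfl
    have e : invCount D (q + 1) (r + L) = invCount D (q + 1) (q + 1) + invCount D (q + 1) m := by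
      have := invCount_add_mul (D := D) (q := q + 1) 1 m
      rw [hm]; simpa using this
    have e' : (L : ℝ) / (q + 1 : ℕ) = 1 + m / (q + 1 : ℕ) - r / (q + 1 : ℕ) := by
      have : (r : ℝ) + L = ((q + 1 : ℕ) : ℝ) + m := by exact_mod_cast hm
      field_simp
      linarith
    rw [e, e']
    rw [div_self hq0] at h2
    push_cast [Nat.cast_add] at *
    rw [abs_le] at *
    constructor <;> nlinarith

end UniformCount

/-! ### Averages weighted by the totient -/

section TotientSums

/-- The parameter `x` is real because it will be `Q / d`. The piece between `⌊x⌋ / x` and `1` has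
length at most `1 / x` and is negligible. -/
lemma tendsto_riemann_sum {h : ℝ → ℝ} (hc : Continuous h) :
    Tendsto (fun x : ℝ => x⁻¹ * ∑ m ∈ Finset.range ⌊x⌋₊, h (((m + 1 : ℕ) : ℝ) / x)) atTop
      (𝓝 (∫ t in (0 : ℝ)..1, h t)) := by
  obtain ⟨B, hB⟩ := (isCompact_Icc (a := (0 : ℝ)) (b := 1)).exists_bound_of_continuousOn
    hc.continuousOn
  have hB0 : 0 ≤ B := (norm_nonneg _).trans (hB 0 (by simp))
  have hu : UniformContinuousOn h (Icc 0 1) :=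
    isCompact_Icc.uniformContinuousOn_of_continuous hc.continuousOn
  rw [Metric.tendsto_atTop]
  intro ε hε
  obtain ⟨δ, hδ, hδh⟩ := Metric.uniformContinuousOn_iff.1 hu (ε / 2) (by positivity)
  refine ⟨max 1 (max (2 / δ) (4 * (B + 1) / ε)), fun x hx => ?_⟩
  have hx1 : 1 ≤ x := (le_max_left _ _).trans hx
  have hx2 : 2 / δ ≤ x := ((le_max_left _ _).trans (le_max_right _ _)).trans hx
  have hx3 : 4 * (B + 1) / ε ≤ x := ((le_max_right _ _).trans (le_max_right _ _)).trans hx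
  have hx0 : 0 < x := by linarith
  have hδx : 1 / x < δ := by
    rw [div_le_iff₀ hδ] at hx2
    rw [div_lt_iff₀ hx0]; linarith
  have hBx : B / x < ε / 2 := by
    rw [div_le_iff₀ hε] at hx3
    rw [div_lt_iff₀ hx0]; linarith
  set n := ⌊x⌋₊
  have hn : (n : ℝ) ≤ x := Nat.floor_le hx0.le
  have hn' : x < n + 1 := Nat.lt_floor_add_one x
  have hint : ∀ a b : ℝ, IntervalIntegrable h volume a b := fun a b => hc.intervalIntegrable a b
  have hsplit : ∫ t in (0 : ℝ)..1, h t =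
      (∑ m ∈ Finset.range n, ∫ t in ((m : ℝ) / x)..(((m + 1 : ℕ) : ℝ) / x), h t) +
        ∫ t in ((n : ℝ) / x)..1, h t := by
    rw [intervalIntegral.sum_integral_adjacent_intervals (a := fun m : ℕ => (m : ℝ) / x)
      (fun k _ => hint _ _)]
    simp only [Nat.cast_zero, zero_div]
    rw [intervalIntegral.integral_add_adjacent_intervals (hint _ _) (hint _ _)]
  have hterm : ∀ m ∈ Finset.range n,
      ‖x⁻¹ * h (((m + 1 : ℕ) : ℝ) / x) -
        ∫ t in ((m : ℝ) / x)..(((m + 1 : ℕ) : ℝ) / x), h t‖ ≤ ε / 2 * x⁻¹ := by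
    intro m hm
    have hmn : ((m + 1 : ℕ) : ℝ) ≤ x := by
      refine le_trans ?_ hn
      exact_mod_cast Finset.mem_range.1 hm
    have hlen : ((m + 1 : ℕ) : ℝ) / x - (m : ℝ) / x = x⁻¹ := by
      push_cast; field_simp; ring
    have hle : (m : ℝ) / x ≤ ((m + 1 : ℕ) : ℝ) / x := by
      have : 0 < x⁻¹ := by positivity
      linarith
    have hconst : x⁻¹ * h (((m + 1 : ℕ) : ℝ) / x) =
        ∫ t in ((m : ℝ) / x)..(((m + 1 : ℕ) : ℝ) / x), h (((m + 1 : ℕ) : ℝ) / x) := by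
      rw [intervalIntegral.integral_const, hlen, smul_eq_mul]
    rw [hconst, ← intervalIntegral.integral_sub (by simp) (hint _ _)]
    have := intervalIntegral.norm_integral_le_of_norm_le_const (a := (m : ℝ) / x)
      (b := ((m + 1 : ℕ) : ℝ) / x) (C := ε / 2)
      (f := fun t => h (((m + 1 : ℕ) : ℝ) / x) - h t) ?_
    · rwa [hlen, abs_of_pos (by positivity)] at this
    · intro t ht
      rw [uIoc_of_le hle] at ht
      have hm0 : 0 ≤ (m : ℝ) / x := by positivity
      have hm1 : ((m + 1 : ℕ) : ℝ) / x ≤ 1 := by rwa [div_le_one hx0]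
      refine (hδh _ ⟨by linarith, hm1⟩ t ⟨by linarith [ht.1], by linarith [ht.2]⟩ ?_).le
      rw [Real.dist_eq, abs_of_nonneg (by linarith [ht.2])]
      rw [one_div] at hδx
      linarith [ht.1]
  have hrest : ‖∫ t in ((n : ℝ) / x)..1, h t‖ ≤ B / x := by
    have hnx : (n : ℝ) / x ≤ 1 := by rwa [div_le_one hx0]
    have := intervalIntegral.norm_integral_le_of_norm_le_const (a := (n : ℝ) / x)
      (b := 1) (C := B) (f := h) (fun t ht => by
        rw [uIoc_of_le hnx] at ht
        exact hB t ⟨(by positivity : 0 ≤ (n : ℝ) / x).trans ht.1.le, ht.2⟩)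
    refine this.trans ?_
    rw [div_eq_mul_one_div B x]
    refine mul_le_mul_of_nonneg_left ?_ hB0
    rw [abs_of_nonneg (by linarith), sub_le_iff_le_add, ← add_div, le_div_iff₀ hx0]
    linarith
  rw [dist_eq_norm, hsplit, Finset.mul_sum, ← sub_sub, ← Finset.sum_sub_distrib]
  calc _ ≤ ‖∑ m ∈ Finset.range n, (x⁻¹ * h (((m + 1 : ℕ) : ℝ) / x) -
        ∫ t in ((m : ℝ) / x)..(((m + 1 : ℕ) : ℝ) / x), h t)‖ +
        ‖∫ t in ((n : ℝ) / x)..1, h t‖ := norm_sub_le _ _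
    _ ≤ n * (ε / 2 * x⁻¹) + B / x := by
        refine add_le_add ((norm_sum_le _ _).trans ?_) hrest
        refine (Finset.sum_le_sum hterm).trans ?_
        simp
    _ ≤ ε / 2 + B / x := by
        have : (n : ℝ) * x⁻¹ ≤ 1 := by
          rw [← div_eq_mul_inv]; rwa [div_le_one hx0]
        have h2 : (n : ℝ) * (ε / 2 * x⁻¹) = ε / 2 * (n * x⁻¹) := by ring
        rw [h2]
        have := mul_le_mul_of_nonneg_left this (by positivity : 0 ≤ ε / 2)
        linarith
    _ < ε := by linarith

open ArithmeticFunction in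
lemma totient_eq_sum_moebius {n : ℕ} (hn : 0 < n) :
    (n.totient : ℝ) = ∑ x ∈ n.divisorsAntidiagonal, ((moebius x.1 : ℤ) : ℝ) * (x.2 : ℝ) := by
  have := (sum_eq_iff_sum_mul_moebius_eq (R := ℝ) (f := fun n => (n.totient : ℝ))
    (g := fun n => (n : ℝ))).1 (fun m _ => by exact_mod_cast Nat.sum_totient m) n hn
  exact this.symm

open ArithmeticFunction in
-- Insert `φ(q) = ∑ μ(d) m` over `d m = q` and sum over `m` first.
lemma sum_totient_mul_eq (f : ℕ → ℝ) (Q : ℕ) :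
    ∑ q ∈ Finset.Ioc 0 Q, (q.totient : ℝ) * f q =
      ∑ d ∈ Finset.Ioc 0 Q, ((moebius d : ℤ) : ℝ) *
        ∑ m ∈ Finset.range (Q / d), ((m + 1 : ℕ) : ℝ) * f (d * (m + 1)) := by
  set P := Finset.Ioc 0 Q ×ˢ Finset.Ioc 0 Q
  set F : ℕ × ℕ → ℝ := fun x => ((moebius x.1 : ℤ) : ℝ) * ((x.2 : ℝ) * f (x.1 * x.2))
  calc _ = ∑ q ∈ Finset.Ioc 0 Q, ∑ x ∈ P.filter (fun x => x.1 * x.2 = q), F x := by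
        refine Finset.sum_congr rfl fun q hq => ?_
        rw [Finset.mem_Ioc] at hq
        rw [totient_eq_sum_moebius hq.1, Finset.sum_mul,
          Nat.divisorsAntidiagonal_eq_prod_filter_of_le hq.1.ne' hq.2]
        refine Finset.sum_congr rfl fun x hx => ?_
        rw [← (Finset.mem_filter.1 hx).2]
        simp only [F]; ring
    _ = ∑ x ∈ P.filter (fun x => x.1 * x.2 ∈ Finset.Ioc 0 Q), F x := by
        rw [← Finset.sum_fiberwise_of_maps_to (s := P.filter (fun x => x.1 * x.2 ∈ Finset.Ioc 0 Q))
          (t := Finset.Ioc 0 Q) (g := fun x => x.1 * x.2)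
          (fun x hx => (Finset.mem_filter.1 hx).2)]
        refine Finset.sum_congr rfl fun q hq => ?_
        rw [Finset.filter_filter]
        refine Finset.sum_congr ?_ fun _ _ => rfl
        ext x
        simp only [Finset.mem_filter]
        constructor
        · rintro ⟨h1, h2⟩; exact ⟨h1, h2 ▸ hq, h2⟩
        · rintro ⟨h1, _, h2⟩; exact ⟨h1, h2⟩
    _ = _ := by
        rw [Finset.sum_filter, Finset.sum_product]
        refine Finset.sum_congr rfl fun d hd => ?_
        rw [Finset.mem_Ioc] at hd
        rw [← Finset.sum_filter, Finset.mul_sum]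
        symm
        refine Finset.sum_bij (fun m _ => m + 1) ?_ ?_ ?_ ?_
        · intro m hm
          rw [Finset.mem_range] at hm
          have h1 : (m + 1) * d ≤ Q := (Nat.le_div_iff_mul_le hd.1).1 hm
          have h2 : m + 1 ≤ Q := (Nat.succ_le_of_lt hm).trans (Nat.div_le_self _ _)
          simp only [Finset.mem_filter, Finset.mem_Ioc]
          refine ⟨⟨by omega, h2⟩, Nat.mul_pos hd.1 (by omega), by rwa [mul_comm]⟩
        · intro a _ b _ h; omega
        · intro b hb
          simp only [Finset.mem_filter, Finset.mem_Ioc] at hb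
          refine ⟨b - 1, ?_, by omega⟩
          rw [Finset.mem_range]
          have : b ≤ Q / d := (Nat.le_div_iff_mul_le hd.1).2 (by rw [mul_comm]; exact hb.2.2)
          omega
        · intro m _
          rfl

open ArithmeticFunction in
/-- The constant `∑ μ(d) / d²`. -/
def totientConst : ℝ := ∑' d : ℕ, ((moebius d : ℤ) : ℝ) / (d : ℝ) ^ 2

open ArithmeticFunction in
-- Its product with `ζ(2)` is `1`. The value itself is not needed, since the constant cancels in the
-- final quotient.
lemma totientConst_ne_zero : totientConst ≠ 0 := by
  intro h
  have h1 := LSeries_one_mul_Lseries_moebius (s := 2) (by norm_num)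
  have h2 : LSeries (fun n => ((moebius n : ℤ) : ℂ)) 2 = ((totientConst : ℝ) : ℂ) := by
    rw [totientConst, Complex.ofReal_tsum, LSeries]
    refine tsum_congr fun d => ?_
    rcases eq_or_ne d 0 with rfl | hd
    · simp
    · rw [LSeries.term_of_ne_zero hd]
      push_cast
      norm_cast
  rw [h2, h] at h1
  simp at h1

open ArithmeticFunction in
-- After Möbius inversion the quantity is `∑ μ(d) / d² · R(Q / d)`, with `R` the Riemann sums of `t
-- h(t)`. These are bounded, so dominated convergence applies with majorant `B / d²`.
lemma tendsto_sum_totient_mul {h : ℝ → ℝ} (hc : Continuous h) :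
    Tendsto (fun Q : ℕ => (∑ q ∈ Finset.Ioc 0 Q, (q.totient : ℝ) * h ((q : ℝ) / Q)) / (Q : ℝ) ^ 2)
      atTop (𝓝 (totientConst * ∫ t in (0 : ℝ)..1, t * h t)) := by
  set k : ℝ → ℝ := fun t => t * h t with hk
  have hkc : Continuous k := by fun_prop
  set R : ℝ → ℝ := fun x => x⁻¹ * ∑ m ∈ Finset.range ⌊x⌋₊, k (((m + 1 : ℕ) : ℝ) / x) with hR
  obtain ⟨B, hB⟩ := (isCompact_Icc (a := (0 : ℝ)) (b := 1)).exists_bound_of_continuousOn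
    hkc.continuousOn
  have hB0 : 0 ≤ B := (norm_nonneg _).trans (hB 0 (by simp))
  have hRB : ∀ x : ℝ, 0 ≤ x → |R x| ≤ B := by
    intro x hx
    rcases hx.eq_or_lt with rfl | hx
    · simpa [hR] using hB0
    have h1 : |∑ m ∈ Finset.range ⌊x⌋₊, k (((m + 1 : ℕ) : ℝ) / x)| ≤ ⌊x⌋₊ * B := by
      refine (Finset.abs_sum_le_sum_abs _ _).trans ?_
      refine (Finset.sum_le_sum (g := fun _ => B) fun m hm => ?_).trans (by simp)
      have : ((m + 1 : ℕ) : ℝ) ≤ x :=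
        (Nat.cast_le.2 (Finset.mem_range.1 hm)).trans (Nat.floor_le hx.le)
      exact hB _ ⟨by positivity, by rwa [div_le_one hx]⟩
    rw [hR]
    simp only
    rw [abs_mul, abs_of_pos (by positivity : 0 < x⁻¹), inv_mul_le_iff₀ hx]
    exact h1.trans (mul_le_mul_of_nonneg_right (Nat.floor_le hx.le) hB0)
  have heq : ∀ Q : ℕ, 0 < Q →
      (∑ q ∈ Finset.Ioc 0 Q, (q.totient : ℝ) * h ((q : ℝ) / Q)) / (Q : ℝ) ^ 2 =
        ∑' d : ℕ, ((moebius d : ℤ) : ℝ) / (d : ℝ) ^ 2 * R ((Q : ℝ) / d) := by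
    intro Q hQ
    rw [sum_totient_mul_eq (fun q => h ((q : ℝ) / Q)), tsum_eq_sum (s := Finset.Ioc 0 Q),
      Finset.sum_div]
    · refine Finset.sum_congr rfl fun d hd => ?_
      rw [Finset.mem_Ioc] at hd
      have hd0 : (0 : ℝ) < d := by exact_mod_cast hd.1
      have hQ0 : (0 : ℝ) < Q := by exact_mod_cast hQ
      simp only [hR, hk]
      simp only [Nat.floor_div_eq_div, Finset.mul_sum, Finset.sum_div]
      refine Finset.sum_congr rfl fun m _ => ?_
      have e : ((d * (m + 1) : ℕ) : ℝ) / Q = ((m + 1 : ℕ) : ℝ) / ((Q : ℝ) / d) := by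
        push_cast; field_simp
      rw [e]
      field_simp
    · intro d hd
      rw [Finset.mem_Ioc, not_and_or, not_lt, not_le] at hd
      rcases hd with hd | hd
      · rw [Nat.le_zero.1 hd]; simp
      · have : Q / d = 0 := Nat.div_eq_of_lt hd
        simp [hR, Nat.floor_div_eq_div, this]
  rw [totientConst, ← tsum_mul_right]
  refine Tendsto.congr' (f₁ := fun Q : ℕ =>
    ∑' d : ℕ, ((moebius d : ℤ) : ℝ) / (d : ℝ) ^ 2 * R ((Q : ℝ) / d)) ?_ ?_
  · filter_upwards [eventually_gt_atTop 0] with Q hQ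
    exact (heq Q hQ).symm
  · refine tendsto_tsum_of_dominated_convergence (bound := fun d : ℕ => 1 / (d : ℝ) ^ 2 * B)
      ((Real.summable_one_div_nat_pow.2 (by norm_num)).mul_right B) ?_ ?_
    · intro d
      rcases Nat.eq_zero_or_pos d with rfl | hd
      · simp
      · refine Tendsto.const_mul _ ((tendsto_riemann_sum hkc).comp ?_)
        exact tendsto_natCast_atTop_atTop.atTop_div_const (by exact_mod_cast hd)
    · refine Eventually.of_forall fun Q d => ?_
      rw [norm_mul, norm_div, norm_pow, Real.norm_natCast]
      refine mul_le_mul ?_ (hRB _ (by positivity)) (norm_nonneg _) (by positivity)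
      have : ‖((moebius d : ℤ) : ℝ)‖ ≤ 1 := by
        rw [Real.norm_eq_abs]; exact_mod_cast abs_moebius_le_one (n := d)
      gcongr

/-- Quantities asymptotic to `φ(q) h(q / Q)` have the same weighted average. -/
lemma tendsto_sum_of_approx_totient {h : ℝ → ℝ} (hc : Continuous h) (h01 : ∀ t, |h t| ≤ 1)
    {x : ℕ → ℕ → ℝ} (hx : ∀ Q, ∀ q ∈ Finset.Ioc 0 Q, |x Q q| ≤ q)
    (hx' : ∀ ε > 0, ∃ q₀ : ℕ, ∀ Q, ∀ q ∈ Finset.Ioc 0 Q, q₀ ≤ q →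
      |x Q q - q.totient * h ((q : ℝ) / Q)| ≤ ε * q.totient) :
    Tendsto (fun Q : ℕ => (∑ q ∈ Finset.Ioc 0 Q, x Q q) / (Q : ℝ) ^ 2)
      atTop (𝓝 (totientConst * ∫ t in (0 : ℝ)..1, t * h t)) := by
  have hmain := tendsto_sum_totient_mul hc
  suffices hdiff : Tendsto (fun Q : ℕ => (∑ q ∈ Finset.Ioc 0 Q,
      (x Q q - q.totient * h ((q : ℝ) / Q))) / (Q : ℝ) ^ 2) atTop (𝓝 0) by
    have := hdiff.add hmain
    rw [zero_add] at this
    refine this.congr fun Q => ?_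
    rw [Finset.sum_sub_distrib]; ring
  rw [Metric.tendsto_atTop]
  intro ε hε
  obtain ⟨q₀, hq₀⟩ := hx' (ε / 2) (by positivity)
  -- The `q < q₀` contribute at most `2 q₀` each, so `2 q₀²` in all; this is below `ε Q² / 2` once
  -- `Q ≥ N`.
  obtain ⟨N, hN⟩ := exists_nat_gt (2 * (2 * q₀ ^ 2) / ε)
  refine ⟨max N 1, fun Q hQ => ?_⟩
  have hQ1 : (1 : ℝ) ≤ Q := by exact_mod_cast (le_max_right _ _).trans hQ
  have hQN : (N : ℝ) ≤ Q := by exact_mod_cast (le_max_left _ _).trans hQ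
  have hφ : ∀ q : ℕ, (q.totient : ℝ) ≤ q := fun q => by exact_mod_cast Nat.totient_le q
  have hterm : ∀ q ∈ Finset.Ioc 0 Q, |x Q q - q.totient * h ((q : ℝ) / Q)| ≤
      ε / 2 * Q + (if q < q₀ then 2 * (q₀ : ℝ) else 0) := by
    intro q hq
    have hqQ : (q : ℝ) ≤ Q := by exact_mod_cast (Finset.mem_Ioc.1 hq).2
    split_ifs with hlt
    · have h1 : |q.totient * h ((q : ℝ) / Q)| ≤ q.totient := by
        rw [abs_mul, Nat.abs_cast]
        exact mul_le_of_le_one_right (by positivity) (h01 _)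
      have h2 := abs_sub (x Q q) (q.totient * h ((q : ℝ) / Q))
      have h3 : (q : ℝ) ≤ q₀ := by exact_mod_cast hlt.le
      have h4 : 0 ≤ ε / 2 * Q := by positivity
      linarith [hx Q q hq, hφ q]
    · rw [add_zero]
      refine (hq₀ Q q hq (not_lt.1 hlt)).trans ?_
      exact mul_le_mul_of_nonneg_left ((hφ q).trans hqQ) (by positivity)
  have hsum : |∑ q ∈ Finset.Ioc 0 Q, (x Q q - q.totient * h ((q : ℝ) / Q))| ≤
      ε / 2 * Q ^ 2 + 2 * (q₀ : ℝ) ^ 2 := by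
    refine (Finset.abs_sum_le_sum_abs _ _).trans ((Finset.sum_le_sum hterm).trans ?_)
    rw [Finset.sum_add_distrib, Finset.sum_const, Nat.card_Ioc, nsmul_eq_mul, ← Finset.sum_filter,
      Finset.sum_const, nsmul_eq_mul]
    have hcard : ((Finset.filter (fun q => q < q₀) (Finset.Ioc 0 Q)).card : ℝ) ≤ q₀ := by
      have : (Finset.filter (fun q => q < q₀) (Finset.Ioc 0 Q)).card ≤ (Finset.range q₀).card :=
        Finset.card_le_card fun q hq => Finset.mem_range.2 (Finset.mem_filter.1 hq).2
      rw [Finset.card_range] at this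
      exact_mod_cast this
    have : ((Finset.filter (fun q => q < q₀) (Finset.Ioc 0 Q)).card : ℝ) * (2 * q₀) ≤
        q₀ * (2 * q₀) := by gcongr
    simp only [Nat.sub_zero]
    nlinarith
  rw [dist_zero_right, Real.norm_eq_abs, abs_div, abs_of_pos (by positivity : (0 : ℝ) < Q ^ 2),
    div_lt_iff₀ (by positivity)]
  refine hsum.trans_lt ?_
  rw [div_lt_iff₀ hε] at hN
  have h1 : (N : ℝ) * ε ≤ Q ^ 2 * ε :=
    mul_le_mul_of_nonneg_right (hQN.trans (le_self_pow₀ hQ1 two_ne_zero)) hε.le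
  linarith

end TotientSums

/-! ### Consecutive Farey denominators -/

section FareyNeighbours

lemma sigma_eq (Q : ℕ) : sigma Q = (Q : ℝ) ^ 2 * (3 / Real.pi ^ 2) := by
  have h : (riemannZeta 2).re = Real.pi ^ 2 / 6 := by
    rw [riemannZeta_two]
    norm_cast
  rw [sigma, h]
  field_simp
  ring

lemma sigma_pos {Q : ℕ} (hQ : 0 < Q) : 0 < sigma Q := by
  rw [sigma_eq]; positivity

/-- If `p n ≡ -1` modulo `q` and `Q - q < n ≤ Q`, then `n` is the denominator of the successor of
`p / q` in the Farey sequence of level `Q`. -/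
lemma near_eq_empty_iff {Q q n : ℕ} {p : ℤ} {s : ℝ} (hs : 0 < s) (hq : 0 < q) (hqQ : q ≤ Q)
    (hn : Q < n + q) (hnQ : n ≤ Q) (hdvd : (q : ℤ) ∣ p * n + 1) :
    near Q (Ioc 0 s) ((p : ℝ) / q) = ∅ ↔ (q : ℝ) * n * ((sigma Q)⁻¹ * s) < 1 := by
  have hσ : 0 < sigma Q := sigma_pos (hq.trans_le hqQ)
  have hn0 : 0 < n := by omega
  have hq' : (0 : ℝ) < q := by exact_mod_cast hq
  have hn' : (0 : ℝ) < n := by exact_mod_cast hn0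
  obtain ⟨e, he⟩ := hdvd
  have heR : (p : ℝ) * n + 1 = q * e := by exact_mod_cast he
  constructor
  · intro hempty
    by_contra! hge
    set m : ℤ := ⌊(e : ℝ) / n⌋
    -- With `e = (p n + 1) / q`, the successor is `e / n`, at distance `1 / (q n)`; it is reduced
    -- modulo `1` to lie in `[0, 1)`.
    have hx : Int.fract ((e : ℝ) / n) ∈ near Q (Ioc 0 s) ((p : ℝ) / q) := by
      refine ⟨⟨sigma Q / (q * n), ⟨by positivity, ?_⟩, -m, ?_⟩, ?_, ?_⟩
      · rw [div_le_iff₀ (by positivity)]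
        have := mul_le_mul_of_nonneg_left hge hσ.le
        calc sigma Q = sigma Q * 1 := (mul_one _).symm
          _ ≤ _ := this
          _ = _ := by field_simp
      · have : (e : ℝ) / n = p / q + (sigma Q)⁻¹ * (sigma Q / (q * n)) := by
          field_simp
          linarith
        change (e : ℝ) / n - (m : ℝ) = _
        push_cast
        linarith
      · exact ⟨Int.fract_nonneg _, Int.fract_lt_one _⟩
      · refine ⟨e - n * m, n, ?_, by exact_mod_cast hn0, by exact_mod_cast hnQ, ?_⟩
        · rw [← Int.isCoprime_iff_gcd_eq_one]
          exact ⟨q, q * m - p, by linear_combination -he⟩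
        · rw [Int.fract]
          push_cast
          field_simp
          rfl
    rw [hempty] at hx
    exact hx
  · intro hlt
    by_contra hne
    obtain ⟨x, ⟨t, ht, m, hx⟩, -, p₁, q₁, -, hq₁, hq₁Q, hx'⟩ :=
      Set.nonempty_iff_ne_empty.2 hne
    have hq₁' : (0 : ℝ) < q₁ := by exact_mod_cast hq₁
    set δ := (sigma Q)⁻¹ * t with hδ
    have hδ0 : 0 < δ := mul_pos (inv_pos.2 hσ) ht.1
    have hδle : δ ≤ (sigma Q)⁻¹ * s := mul_le_mul_of_nonneg_left ht.2 (inv_pos.2 hσ).le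
    set k : ℤ := (p₁ - m * q₁) * q - p * q₁ with hk
    have hkR : (k : ℝ) = q * q₁ * δ := by
      have h1 : (p₁ : ℝ) / q₁ = p / q + δ + m := by rw [← hx', hx]
      field_simp at h1
      rw [hk]
      push_cast
      linarith
    have hk0 : 0 < k := by
      have : (0 : ℝ) < k := by rw [hkR]; positivity
      exact_mod_cast this
    have hkn : k * n < q₁ := by
      have : (k : ℝ) * n < q₁ := by
        calc (k : ℝ) * n = q₁ * (q * n * δ) := by rw [hkR]; ring
          _ ≤ q₁ * (q * n * ((sigma Q)⁻¹ * s)) := by gcongr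
          _ < q₁ * 1 := by gcongr
          _ = q₁ := mul_one _
      exact_mod_cast this
    -- The vectors `(p, q)` and `(e, n)` form a basis of `ℤ²`, and `j, k` are the coordinates of the
    -- new point. A point closer than the successor has `k, j ≥ 1`, so its denominator `k n + j q`
    -- is at least `n + q > Q`.
    set j : ℤ := e * q₁ - (p₁ - m * q₁) * n with hj
    have hjeq : (q₁ : ℤ) = k * n + q * j := by
      rw [hk, hj]; linear_combination q₁ * he
    have hj0 : 0 < j := by
      by_contra! h
      have : (q : ℤ) * j ≤ 0 := mul_nonpos_of_nonneg_of_nonpos (by positivity) h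
      omega
    have h1 : (q : ℤ) ≤ q * j := le_mul_of_one_le_right (by positivity) hj0
    have h2 : (n : ℤ) ≤ k * n := le_mul_of_one_le_left (by positivity) hk0
    omega

/-- The pairs `(k, n)` with `k + 1 ≤ Q` and `n ∈ (Q - k - 1, Q]`; here `k + 1` and `n` are the
denominators of consecutive Farey fractions. -/
def denominatorPairs (D : Set UnitAddCircle) (Q : ℕ) (R : ℕ → ℕ → Prop) : Set (ℕ × ℕ) :=
  {x | x.1 < Q ∧ Q < x.2 + (x.1 + 1) ∧ x.2 ≤ Q ∧ InvMem D (x.1 + 1) x.2 ∧ R (x.1 + 1) x.2}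

/-- The Farey fraction determined by its denominator `k + 1` and that of its successor, `n`. -/
def fractionOf (x : ℕ × ℕ) : ℝ :=
  ((-(x.2 : ZMod (x.1 + 1))⁻¹).val : ℝ) / ((x.1 + 1 : ℕ) : ℝ)

lemma val_mul_add_one_dvd {q n : ℕ} [NeZero q] (h : IsUnit (n : ZMod q)) :
    (q : ℤ) ∣ ((-(n : ZMod q)⁻¹).val : ℤ) * n + 1 := by
  rw [← ZMod.intCast_zmod_eq_zero_iff_dvd]
  push_cast
  rw [ZMod.natCast_zmod_val, neg_mul, ZMod.inv_mul_of_unit _ h]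
  simp

lemma isCoprime_of_dvd_mul_add_one {q p n : ℤ} (h : q ∣ p * n + 1) : IsCoprime p q := by
  obtain ⟨e, he⟩ := h
  exact ⟨-n, e, by linear_combination -he⟩

lemma fractionOf_mem_points {Q k n : ℕ} (hk : k < Q) (h : IsUnit (n : ZMod (k + 1))) :
    fractionOf (k, n) ∈ points Q := by
  have hq : (0 : ℝ) < ((k + 1 : ℕ) : ℝ) := by positivity
  refine ⟨⟨by unfold fractionOf; positivity, ?_⟩, ((-(n : ZMod (k + 1))⁻¹).val : ℤ),
    ((k + 1 : ℕ) : ℤ), ?_, by positivity, by exact_mod_cast hk, ?_⟩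
  · rw [fractionOf, div_lt_one hq]
    exact_mod_cast ZMod.val_lt _
  · rw [← Int.isCoprime_iff_gcd_eq_one]
    exact isCoprime_of_dvd_mul_add_one (val_mul_add_one_dvd h)
  · rw [fractionOf]
    push_cast
    rfl

lemma eq_of_div_eq_div_of_coprime {a b c d : ℤ} (hb : 0 < b) (hd : 0 < d) (h1 : IsCoprime a b)
    (h2 : IsCoprime c d) (h : (a : ℝ) / b = c / d) : a = c ∧ b = d := by
  have hb' : (b : ℝ) ≠ 0 := by exact_mod_cast hb.ne'
  have hd' : (d : ℝ) ≠ 0 := by exact_mod_cast hd.ne'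
  rw [div_eq_div_iff hb' hd'] at h
  have h' : a * d = c * b := by exact_mod_cast h
  have hbd : b ∣ d := h1.symm.dvd_of_dvd_mul_left ⟨c, by linarith⟩
  have hdb : d ∣ b := h2.symm.dvd_of_dvd_mul_left ⟨a, by linarith⟩
  have hbd' : b = d := Int.dvd_antisymm hb.le hd.le hbd hdb
  subst hbd'
  exact ⟨mul_right_cancel₀ hb.ne' h', rfl⟩

/-- A reduced fraction determines `p` and `q`, hence `n` modulo `q`; the window contains one
representative of each class. -/
lemma fractionOf_injOn {D : Set UnitAddCircle} {Q : ℕ} {R : ℕ → ℕ → Prop} :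
    InjOn fractionOf (denominatorPairs D Q R) := by
  rintro ⟨k, n⟩ ⟨h1, h2, h3, h4, -⟩ ⟨k', n'⟩ ⟨h1', h2', h3', h4', -⟩ h
  simp only at h1 h2 h3 h4 h1' h2' h3' h4'
  obtain ⟨hp, hq⟩ := eq_of_div_eq_div_of_coprime
    (a := ((-(n : ZMod (k + 1))⁻¹).val : ℤ)) (b := ((k + 1 : ℕ) : ℤ))
    (c := ((-(n' : ZMod (k' + 1))⁻¹).val : ℤ)) (d := ((k' + 1 : ℕ) : ℤ))
    (by positivity) (by positivity)
    (isCoprime_of_dvd_mul_add_one (val_mul_add_one_dvd h4.1))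
    (isCoprime_of_dvd_mul_add_one (val_mul_add_one_dvd h4'.1)) (by
      simpa only [fractionOf, Int.cast_natCast] using h)
  have hk : k = k' := by omega
  subst hk
  have hval : -(n : ZMod (k + 1))⁻¹ = -(n' : ZMod (k + 1))⁻¹ :=
    ZMod.val_injective _ (by exact_mod_cast hp)
  have hnn : (n : ZMod (k + 1)) = n' := by
    have := congrArg (fun z => -z * (n' : ZMod (k + 1)) * n) hval
    simp only [neg_neg] at this
    rw [ZMod.inv_mul_of_unit _ h4'.1, one_mul, mul_right_comm, ZMod.inv_mul_of_unit _ h4.1,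
      one_mul] at this
    exact this.symm
  rw [ZMod.natCast_eq_natCast_iff] at hnn
  have hnn' : n = n' := by
    rcases le_total n n' with hle | hle
    · have := (Nat.modEq_iff_dvd' hle).1 hnn
      have := Nat.eq_zero_of_dvd_of_lt this (by omega)
      omega
    · have := (Nat.modEq_iff_dvd' hle).1 hnn.symm
      have := Nat.eq_zero_of_dvd_of_lt this (by omega)
      omega
  rw [hnn']

lemma exists_fractionOf_eq {Q : ℕ} {r : ℝ} (hr : r ∈ points Q) :
    ∃ k n : ℕ, k < Q ∧ Q < n + (k + 1) ∧ n ≤ Q ∧ IsUnit (n : ZMod (k + 1)) ∧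
      fractionOf (k, n) = r := by
  obtain ⟨⟨hr0, hr1⟩, p, q, hpq, hq0, hqQ, rfl⟩ := hr
  obtain ⟨k, hk⟩ : ∃ k : ℕ, q = ((k + 1 : ℕ) : ℤ) := ⟨(q - 1).toNat, by omega⟩
  subst hk
  have hq' : (0 : ℝ) < (((k + 1 : ℕ) : ℤ) : ℝ) := by exact_mod_cast hq0
  have hp0 : 0 ≤ p := by
    by_contra! h
    exact absurd hr0 (not_le.2 (div_neg_of_neg_of_pos (by exact_mod_cast h) hq'))
  have hpq' : p < ((k + 1 : ℕ) : ℤ) := by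
    rw [div_lt_one hq'] at hr1
    exact_mod_cast hr1
  obtain ⟨p, rfl⟩ := Int.eq_ofNat_of_zero_le hp0
  have hpu : IsUnit (p : ZMod (k + 1)) := (ZMod.isUnit_iff_coprime _ _).2 (by exact_mod_cast hpq)
  set c : ZMod (k + 1) := -(p : ZMod (k + 1))⁻¹ with hc
  have hcu : IsUnit c := by
    obtain ⟨u, hu⟩ := hpu
    rw [hc, ← hu, ZMod.inv_coe_unit]
    exact (Units.isUnit _).neg
  -- The distance from `Q` down to the nearest integer congruent to `c = -p⁻¹`; since `m ≤ k`, the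
  -- number `Q - m` lies in the window.
  set m : ℕ := ((Q : ZMod (k + 1)) - c).val with hm
  have hmlt : m < k + 1 := ZMod.val_lt _
  have hkQ : k + 1 ≤ Q := by exact_mod_cast hqQ
  have hcast : ((Q - m : ℕ) : ZMod (k + 1)) = c := by
    rw [Nat.cast_sub (by omega), hm, ZMod.natCast_zmod_val]
    ring
  refine ⟨k, Q - m, by omega, by omega, by omega, by rw [hcast]; exact hcu, ?_⟩
  have hval : (-((Q - m : ℕ) : ZMod (k + 1))⁻¹).val = p := by
    rw [hcast]
    have : -c⁻¹ = (p : ZMod (k + 1)) := by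
      obtain ⟨u, hu⟩ := hpu
      have : c = ((-u⁻¹ : (ZMod (k + 1))ˣ) : ZMod (k + 1)) := by
        rw [hc, ← hu, ZMod.inv_coe_unit]; simp
      rw [this, ZMod.inv_coe_unit, ← hu]
      simp
    rw [this, ZMod.val_cast_of_lt (by exact_mod_cast hpq')]
  simp only [fractionOf]
  rw [hval]
  simp

lemma image_fractionOf {D : Set UnitAddCircle} {Q : ℕ} {P : ℝ → Prop} {R : ℕ → ℕ → Prop}
    (hPR : ∀ k n : ℕ, k < Q → Q < n + (k + 1) → n ≤ Q → IsUnit (n : ZMod (k + 1)) →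
      (P (fractionOf (k, n)) ↔ R (k + 1) n)) :
    fractionOf '' denominatorPairs D Q R = {r | r ∈ pointsIn Q D ∧ P r} := by
  have hcoe : ∀ k n : ℕ, ((fractionOf (k, n) : ℝ) : UnitAddCircle) =
      ZMod.toAddCircle (-(n : ZMod (k + 1))⁻¹) := fun k n => by
    rw [ZMod.toAddCircle_apply, fractionOf]
  ext r
  constructor
  · rintro ⟨⟨k, n⟩, ⟨h1, h2, h3, h4, h5⟩, rfl⟩
    refine ⟨⟨fractionOf_mem_points h1 h4.1, ?_⟩, (hPR k n h1 h2 h3 h4.1).2 h5⟩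
    rw [hcoe]; exact h4.2
  · rintro ⟨⟨hr, hD⟩, hP⟩
    obtain ⟨k, n, h1, h2, h3, h4, rfl⟩ := exists_fractionOf_eq hr
    rw [hcoe] at hD
    exact ⟨(k, n), ⟨h1, h2, h3, ⟨h4, hD⟩, (hPR k n h1 h2 h3 h4).1 hP⟩, rfl⟩

lemma ncard_pointsIn_eq (D : Set UnitAddCircle) (Q : ℕ) :
    (pointsIn Q D).ncard = (denominatorPairs D Q fun _ _ => True).ncard := by
  rw [← fractionOf_injOn.ncard_image,
    image_fractionOf (P := fun _ => True) (fun _ _ _ _ _ _ => Iff.rfl)]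
  simp

lemma ncard_near_eq_zero (D : Set UnitAddCircle) (Q : ℕ) {s : ℝ} (hs : 0 < s) :
    {r | r ∈ pointsIn Q D ∧ (near Q (Ioc 0 s) r).encard = ((0 : ℕ) : ℕ∞)}.ncard =
      (denominatorPairs D Q fun q n => (q : ℝ) * n * ((sigma Q)⁻¹ * s) < 1).ncard := by
  rw [← fractionOf_injOn.ncard_image, image_fractionOf
    (P := fun r => (near Q (Ioc 0 s) r).encard = ((0 : ℕ) : ℕ∞))]
  intro k n h1 h2 h3 h4
  rw [Nat.cast_zero, Set.encard_eq_zero]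
  have := near_eq_empty_iff (p := ((-(n : ZMod (k + 1))⁻¹).val : ℤ)) hs (by omega : 0 < k + 1) h1 h2 h3
    (val_mul_add_one_dvd h4)
  simpa only [fractionOf, Int.cast_natCast] using this

lemma ncard_denominatorPairs (D : Set UnitAddCircle) (Q : ℕ) (R : ℕ → ℕ → Prop) :
    (denominatorPairs D Q R).ncard = ∑ k ∈ Finset.range Q,
      {n : ℕ | Q < n + (k + 1) ∧ n ≤ Q ∧ InvMem D (k + 1) n ∧ R (k + 1) n}.ncard := by
  classical
  set S : ℕ → Finset ℕ := fun k => (Finset.range (Q + 1)).filter fun n =>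
    Q < n + (k + 1) ∧ n ≤ Q ∧ InvMem D (k + 1) n ∧ R (k + 1) n with hS
  have h1 : denominatorPairs D Q R =
      (((Finset.range Q).sigma S).map (Equiv.sigmaEquivProd ℕ ℕ).toEmbedding : Set (ℕ × ℕ)) := by
    ext ⟨k, n⟩
    simp only [denominatorPairs, mem_ofPred_eq, Finset.coe_map, Equiv.coe_toEmbedding,
      mem_image_equiv, Finset.mem_coe, Finset.mem_sigma, hS, Finset.mem_filter, Finset.mem_range,
      Equiv.sigmaEquivProd_symm_apply]
    constructor
    · rintro ⟨h1, h2, h3, h4, h5⟩; exact ⟨h1, by omega, h2, h3, h4, h5⟩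
    · rintro ⟨h1, -, h2, h3, h4, h5⟩; exact ⟨h1, h2, h3, h4, h5⟩
  rw [h1, Set.ncard_coe_finset, Finset.card_map, Finset.card_sigma]
  refine Finset.sum_congr rfl fun k _ => ?_
  rw [← Set.ncard_coe_finset]
  congr 1
  ext n
  simp only [hS, Finset.coe_filter, Finset.mem_range, mem_ofPred_eq]
  constructor
  · rintro ⟨_, h⟩; exact h
  · intro h; exact ⟨by omega, h⟩

end FareyNeighbours

/-! ### The limit of the gap counts -/

section GapLimit

/-- The proportion of the interval `(1 - t, 1]` on which `t y < a`. -/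
def gapProfile (a t : ℝ) : ℝ := max 0 (min 1 (a / t ^ 2 - 1 / t + 1))

lemma gapProfile_nonneg (a t : ℝ) : 0 ≤ gapProfile a t := le_max_left _ _

lemma gapProfile_le_one (a t : ℝ) : gapProfile a t ≤ 1 :=
  max_le zero_le_one (min_le_left _ _)

lemma gapProfile_eq_one {a t : ℝ} (ht : t ≤ a) : gapProfile a t = 1 := by
  have h : 1 ≤ a / t ^ 2 - 1 / t + 1 := by
    -- At `t = 0` both quotients are `0` by convention, so the profile is `1`, as continuity at `0`
    -- requires.
    rcases eq_or_ne t 0 with rfl | h0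
    · simp
    · have : a / t ^ 2 - 1 / t = (a - t) / t ^ 2 := by field_simp
      have h2 : 0 ≤ (a - t) / t ^ 2 := div_nonneg (by linarith) (by positivity)
      linarith
  rw [gapProfile, min_eq_left h, max_eq_right zero_le_one]

lemma continuous_gapProfile {a : ℝ} (ha : 0 < a) : Continuous (gapProfile a) := by
  rw [continuous_iff_continuousAt]
  intro t
  rcases eq_or_ne t 0 with rfl | h0
  · refine (continuousAt_const (y := (1 : ℝ))).congr ?_
    filter_upwards [Iio_mem_nhds ha] with t ht
    exact (gapProfile_eq_one (le_of_lt ht)).symm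
  · unfold gapProfile
    refine ContinuousAt.sup continuousAt_const (ContinuousAt.inf continuousAt_const ?_)
    exact ((continuousAt_const.div (continuousAt_id.pow 2) (pow_ne_zero 2 h0)).sub
      (continuousAt_const.div continuousAt_id h0)).add continuousAt_const

lemma ncard_invMem_Ico (D : Set UnitAddCircle) (q : ℕ) [NeZero q] (N L : ℕ) :
    (({n : ℕ | N ≤ n ∧ n < N + L ∧ InvMem D q n}.ncard : ℕ) : ℝ) =
      invCount D q (N + L) - invCount D q N := by
  classical
  have h : invCount D q (N + L) =
      invCount D q N + {n : ℕ | N ≤ n ∧ n < N + L ∧ InvMem D q n}.ncard := by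
    simp only [invCount, Nat.count_eq_card_filter_range]
    have hfin : {n : ℕ | N ≤ n ∧ n < N + L ∧ InvMem D q n}.Finite :=
      (Set.finite_lt_nat (N + L)).subset fun n hn => hn.2.1
    rw [← Set.ncard_coe_finset, ← Set.ncard_coe_finset,
      ← Set.ncard_union_eq ?_ (Finset.finite_toSet _) hfin]
    · congr 1
      ext n
      simp only [Finset.coe_filter, Finset.mem_range, mem_ofPred_eq, mem_union]
      constructor
      · rintro ⟨h1, h2⟩
        rcases lt_or_ge n N with h | h
        · exact Or.inl ⟨h, h2⟩
        · exact Or.inr ⟨h, h1, h2⟩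
      · rintro (⟨h1, h2⟩ | ⟨h1, h2, h3⟩)
        · exact ⟨by omega, h2⟩
        · exact ⟨h2, h3⟩
    · rw [Set.disjoint_left]
      intro n h1 h2
      simp only [Finset.coe_filter, Finset.mem_range, mem_ofPred_eq] at h1 h2
      omega
  rw [h]; push_cast; ring

lemma ncard_invMem_Ico_le (D : Set UnitAddCircle) (q : ℕ) [NeZero q] (N L : ℕ) :
    {n : ℕ | N ≤ n ∧ n < N + L ∧ InvMem D q n}.ncard ≤ L := by
  calc _ ≤ ((Finset.Ico N (N + L) : Finset ℕ) : Set ℕ).ncard :=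
        Set.ncard_le_ncard (fun n hn => by simpa using ⟨hn.1, hn.2.1⟩) (Finset.finite_toSet _)
    _ = L := by rw [Set.ncard_coe_finset]; simp

/-- Weighted counts of Farey denominators: if, for consecutive denominators `q, n`, the relation
`R Q q n` cuts out an initial part of the window `(Q - q, Q]` of relative length `h (q / Q)` up to
`O(1 / q)`, then the number of Farey fractions satisfying it is determined by `h`. -/
lemma tendsto_ncard_denominatorPairs {D : Set UnitAddCircle} (hD : volume (frontier D) = 0)
    {h : ℝ → ℝ} (hc : Continuous h) (h0 : ∀ t, 0 ≤ h t) (h1 : ∀ t, h t ≤ 1)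
    {R : ℕ → ℕ → ℕ → Prop} (L : ℕ → ℕ → ℕ)
    (hL : ∀ Q q, 0 < q → q ≤ Q → L Q q ≤ q)
    (hR : ∀ Q q n, 0 < q → q ≤ Q → Q < n + q →
      ((n ≤ Q ∧ R Q q n) ↔ n < Q + 1 - q + L Q q))
    (hLh : ∀ Q q, 0 < q → q ≤ Q → |(L Q q : ℝ) / q - h ((q : ℝ) / Q)| ≤ 1 / q) :
    Tendsto (fun Q : ℕ => ((denominatorPairs D Q (R Q)).ncard : ℝ) / (Q : ℝ) ^ 2) atTop
      (𝓝 (totientConst * ∫ t in (0 : ℝ)..1, t * ((volume D).toReal * h t))) := by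
  set ρ := (volume D).toReal with hρ
  have hρ0 : 0 ≤ ρ := ENNReal.toReal_nonneg
  have hρ1 : ρ ≤ 1 := by
    have : volume D ≤ 1 := prob_le_one
    simpa using ENNReal.toReal_mono ENNReal.one_ne_top this
  -- The modulus is written `q - 1 + 1` so that it is visibly nonzero for every `q`.
  set x : ℕ → ℕ → ℝ := fun Q q =>
    (({n : ℕ | Q + 1 - q ≤ n ∧ n < Q + 1 - q + L Q q ∧ InvMem D (q - 1 + 1) n}.ncard : ℕ) : ℝ)
    with hx
  have hsum : ∀ Q : ℕ, ((denominatorPairs D Q (R Q)).ncard : ℝ) =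
      ∑ q ∈ Finset.Ioc 0 Q, x Q q := by
    intro Q
    rw [ncard_denominatorPairs, Nat.cast_sum]
    refine Finset.sum_bij (fun k _ => k + 1) ?_ ?_ ?_ ?_
    · intro k hk; rw [Finset.mem_range] at hk; rw [Finset.mem_Ioc]; omega
    · intro a _ b _ hab; omega
    · intro q hq
      rw [Finset.mem_Ioc] at hq
      exact ⟨q - 1, Finset.mem_range.2 (by omega), by omega⟩
    · intro k hk
      rw [Finset.mem_range] at hk
      simp only [hx]
      congr 2
      ext n
      simp only [mem_ofPred_eq, Nat.add_sub_cancel]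
      constructor
      · rintro ⟨e1, e2, e3, e4⟩
        exact ⟨by omega, (hR Q (k + 1) n k.succ_pos hk e1).1 ⟨e2, e4⟩, e3⟩
      · rintro ⟨e1, e2, e3⟩
        have e5 : Q < n + (k + 1) := by omega
        obtain ⟨e6, e7⟩ := (hR Q (k + 1) n k.succ_pos hk e5).2 e2
        exact ⟨e5, e6, e3, e7⟩
  simp_rw [hsum]
  apply tendsto_sum_of_approx_totient
  · fun_prop
  · intro t
    rw [abs_of_nonneg (mul_nonneg hρ0 (h0 t))]
    exact mul_le_one₀ hρ1 (h0 t) (h1 t)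
  · intro Q q hq
    rw [Finset.mem_Ioc] at hq
    simp only [hx, Nat.abs_cast, Nat.cast_le]
    exact (ncard_invMem_Ico_le D _ _ _).trans (hL Q q hq.1 hq.2)
  · intro ε hε
    obtain ⟨q₀, hq₀⟩ := exists_abs_invCount_sub_invCount_le hD (ε := ε / 2) (by positivity)
    obtain ⟨q₁, hq₁⟩ := exists_nat_gt (2 / ε)
    refine ⟨max (q₀ + 1) q₁, fun Q q hq hle => ?_⟩
    rw [Finset.mem_Ioc] at hq
    have hle0 : q₀ + 1 ≤ q := (le_max_left _ _).trans hle
    have hle1 : (q₁ : ℝ) ≤ q := by exact_mod_cast (le_max_right _ _).trans hle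
    have hq0 : (0 : ℝ) < q := by exact_mod_cast hq.1
    have hqs : q - 1 + 1 = q := by omega
    have hb := hq₀ (q - 1) (by omega) (Q + 1 - q) (L Q q) (by
      rw [hqs]; exact hL Q q hq.1 hq.2)
    have hε1 : 1 / (q : ℝ) ≤ ε / 2 := by
      rw [div_lt_iff₀ hε] at hq₁
      rw [div_le_iff₀ hq0]
      nlinarith
    have hw := (hLh Q q hq.1 hq.2).trans hε1
    simp only [hx, ncard_invMem_Ico]
    have hφeq : ((q - 1 + 1).totient : ℝ) = q.totient := by rw [hqs]
    have hqeq : ((q - 1 + 1 : ℕ) : ℝ) = q := by rw [hqs]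
    rw [← hρ, hφeq, hqeq] at hb
    set φ : ℝ := (q.totient : ℝ)
    have hφ : 0 ≤ φ := by positivity
    set y := (L Q q : ℝ) / q
    have hw' : |ρ * φ * y - φ * (ρ * h ((q : ℝ) / Q))| ≤ ε / 2 * φ := by
      rw [show ρ * φ * y - φ * (ρ * h ((q : ℝ) / Q)) = ρ * φ * (y - h ((q : ℝ) / Q)) by ring,
        abs_mul, abs_of_nonneg (mul_nonneg hρ0 hφ)]
      calc ρ * φ * |y - h ((q : ℝ) / Q)| ≤ 1 * φ * (ε / 2) := by gcongr
        _ = _ := by ring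
    have := abs_add_le _ _ |>.trans (add_le_add hb hw')
    calc _ = _ := by congr 1; ring
      _ ≤ _ := this
      _ = _ := by ring

/-- Numerator and denominator are instances of the same count, with profiles `gapProfile a` and `1`.
The factors `Q²`, `totientConst` and `vol(D)` cancel, and `∫ t dt = 1/2` over `[0, 1]` produces the
factor `2`. -/
lemma tendsto_P0Q {s a : ℝ} (hs : 0 < s) (ha : a = (Real.pi ^ 2 / 3 * s)⁻¹)
    {D : Set UnitAddCircle} (hD : volume (frontier D) = 0) (hDi : (interior D).Nonempty) :
    Tendsto (fun Q : ℕ => P0Q Q 0 D (Ioc 0 s)) atTop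
      (𝓝 (∫ t in (0 : ℝ)..1, 2 * t * gapProfile a t)) := by
  have ha0 : 0 < a := by rw [ha]; positivity
  have hδ : ∀ Q : ℕ, (sigma Q)⁻¹ * s = (a * (Q : ℝ) ^ 2)⁻¹ := by
    intro Q
    rw [sigma_eq, ha]
    rcases Nat.eq_zero_or_pos Q with rfl | hQ
    · simp
    · field_simp
  have hρ : 0 < (volume D).toReal := by
    refine ENNReal.toReal_pos ?_ (measure_ne_top _ _)
    exact ((isOpen_interior.measure_pos volume hDi).trans_le (measure_mono interior_subset)).ne'
  set ρ := (volume D).toReal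
  have hden := tendsto_ncard_denominatorPairs hD (h := fun _ => 1) continuous_const
    (fun _ => zero_le_one) (fun _ => le_rfl) (R := fun _ _ _ => True) (fun _ q => q)
    (fun _ _ _ _ => le_rfl) (fun Q q n _ hqQ _ => by simp only [and_true]; omega)
    (fun Q q hq _ => by
      have : (q : ℝ) ≠ 0 := by exact_mod_cast hq.ne'
      simp [div_self this])
  -- The least `n` for which `q n < a Q²` fails.
  set N2 : ℕ → ℕ → ℕ := fun Q q => ⌈a * (Q : ℝ) ^ 2 / q⌉₊ with hN2
  have hnum := tendsto_ncard_denominatorPairs hD (continuous_gapProfile ha0)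
    (gapProfile_nonneg a) (gapProfile_le_one a)
    (R := fun Q q n => (q : ℝ) * n * ((sigma Q)⁻¹ * s) < 1)
    (fun Q q => min (Q + 1) (N2 Q q) - (Q + 1 - q))
    (fun Q q _ hqQ => by omega)
    (fun Q q n hq hqQ hn => by
      have hQ : (0 : ℝ) < Q := by exact_mod_cast hq.trans_le hqQ
      have hq' : (0 : ℝ) < q := by exact_mod_cast hq
      have : (q : ℝ) * n * ((sigma Q)⁻¹ * s) < 1 ↔ n < N2 Q q := by
        rw [hN2, Nat.lt_ceil, hδ, ← div_eq_mul_inv, div_lt_one (by positivity), lt_div_iff₀ hq',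
          mul_comm (n : ℝ)]
      rw [this]
      omega)
    (fun Q q hq hqQ => by
      have hQ : (0 : ℝ) < Q := by exact_mod_cast hq.trans_le hqQ
      have hq' : (0 : ℝ) < q := by exact_mod_cast hq
      set X : ℝ := a * (Q : ℝ) ^ 2 / q with hX
      have hX0 : 0 < X := by positivity
      have hc1 : (N2 Q q : ℝ) < X + 1 := Nat.ceil_lt_add_one hX0.le
      have hc2 : X ≤ N2 Q q := Nat.le_ceil _
      have hL : ((min (Q + 1) (N2 Q q) - (Q + 1 - q) : ℕ) : ℝ) =
          max 0 (min (q : ℝ) (N2 Q q - Q - 1 + q)) := by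
        have e : (((min (Q + 1) (N2 Q q) - (Q + 1 - q) : ℕ) : ℤ)) =
            max 0 (min (q : ℤ) (N2 Q q - Q - 1 + q)) := by omega
        exact_mod_cast congrArg (fun z : ℤ => (z : ℝ)) e
      have hg : gapProfile a ((q : ℝ) / Q) = max 0 (min (q : ℝ) (X - Q + q)) / q := by
        have e : a / ((q : ℝ) / Q) ^ 2 - 1 / ((q : ℝ) / Q) + 1 = (X - Q + q) / q := by
          rw [hX]; field_simp
        rw [gapProfile, e, ← max_div_div_right hq'.le, ← min_div_div_right hq'.le, zero_div,
          div_self hq'.ne']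
      rw [hL, hg, ← sub_div, abs_div, abs_of_pos hq']
      gcongr
      -- Clamping is 1-Lipschitz, so replacing the ceiling `N2 - 1` by the real number `X` costs at
      -- most `1`.
      refine (abs_max_sub_max_le_max _ _ _ _).trans (max_le (by simp) ?_)
      refine (abs_min_sub_min_le_max _ _ _ _).trans (max_le (by simp) ?_)
      rw [abs_le]
      constructor <;> linarith)
  have hQ2 : ∀ᶠ Q : ℕ in atTop, (Q : ℝ) ^ 2 ≠ 0 := by
    filter_upwards [eventually_gt_atTop 0] with Q hQ
    positivity
  have hlim := hnum.div hden ?_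
  · have hval : (totientConst * ∫ t in (0 : ℝ)..1, t * (ρ * gapProfile a t)) /
        (totientConst * ∫ t in (0 : ℝ)..1, t * (ρ * 1)) =
        ∫ t in (0 : ℝ)..1, 2 * t * gapProfile a t := by
      have e1 : ∫ t in (0 : ℝ)..1, t * (ρ * gapProfile a t) =
          ρ / 2 * ∫ t in (0 : ℝ)..1, 2 * t * gapProfile a t := by
        rw [← intervalIntegral.integral_const_mul]
        congr 1; ext t; ring
      have e2 : ∫ t in (0 : ℝ)..1, t * (ρ * 1) = ρ / 2 := by
        rw [intervalIntegral.integral_mul_const, integral_id]; norm_num; ring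
      rw [e1, e2]
      have := totientConst_ne_zero
      field_simp
    rw [← hval]
    refine hlim.congr' ?_
    filter_upwards [hQ2] with Q hQ
    simp only [Pi.div_apply]
    rw [div_div_div_cancel_right₀ hQ, P0Q, ncard_near_eq_zero D Q hs, ncard_pointsIn_eq]
  · rw [intervalIntegral.integral_mul_const, integral_id]
    exact mul_ne_zero totientConst_ne_zero (by norm_num; exact hρ.ne')

end GapLimit

/-! ### The limit as a measure on the closed horocycle -/

section HorocycleSection

lemma sigma_one : sigma 1 = 3 / Real.pi ^ 2 := by
  rw [sigma_eq]; simp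

lemma vecMul_hMat (p q b : ℝ) : ![p, q] ᵥ* hMat b = ![p, p * b + q] := by
  ext i; fin_cases i <;> simp [hMat, Matrix.vecMul, dotProduct]

lemma vecMul_aMat (v : Fin 2 → ℝ) (y : ℝ) : v ᵥ* aMat y = ![v 0 * y, v 1 * y⁻¹] := by
  ext i; fin_cases i <;> simp [aMat, Matrix.vecMul, dotProduct]

/-- Undo the scaling: the point becomes `(u / √l, √l v)`. Since `a = σ_1 / s`, the bound on the
slope turns into `a u ≤ √l (√l v)`. -/
lemma mem_coneScaled_iff {l s a : ℝ} (hl : 0 < l) (hs : 0 < s)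
    (ha : a = (Real.pi ^ 2 / 3 * s)⁻¹) (u v : ℝ) :
    ![u, v] ∈ coneScaled l (Ioc 0 s) ↔
      0 < √l * v ∧ √l * v ≤ 1 ∧ 0 < u ∧ a * u ≤ √l * (√l * v) := by
  have hx : 0 < √l := Real.sqrt_pos.2 hl
  set x := √l with hxdef
  have hmem : ![u, v] ∈ coneScaled l (Ioc 0 s) ↔ ![u / x, v * x] ∈ cone (Ioc 0 s) := by
    constructor
    · rintro ⟨w, hw, hwv⟩
      replace hwv : w ᵥ* aMat x = ![u, v] := hwv
      rw [vecMul_aMat] at hwv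
      have h0 : w 0 * x = u := congrFun hwv 0
      have h1 : w 1 * x⁻¹ = v := congrFun hwv 1
      convert hw using 1
      ext i
      fin_cases i
      · simp [← h0, hx.ne']
      · simp [← h1, hx.ne']
    · intro h
      refine ⟨_, h, ?_⟩
      change ![u / x, v * x] ᵥ* aMat x = ![u, v]
      rw [vecMul_aMat]
      ext i
      fin_cases i <;> simp [hx.ne']
  rw [hmem]
  simp only [cone, mem_ofPred_eq, Matrix.cons_val_zero, Matrix.cons_val_one, sigma_one]
  rw [mul_comm v x]
  refine and_congr_right fun hv => and_congr_right fun _ => ?_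
  set y := x * v
  have hπ : 0 < Real.pi := Real.pi_pos
  rw [Set.mem_smul_set]
  simp only [smul_eq_mul]
  constructor
  · rintro ⟨t, ht, hu⟩
    have hu' : u = x * ((3 / Real.pi ^ 2)⁻¹ * y * t) := by rw [hu]; field_simp
    have ht0 : 0 < t := ht.1
    refine ⟨by rw [hu']; positivity, ?_⟩
    have e : a * u = x * y * (t / s) := by rw [hu', ha]; field_simp
    have h1 : t / s ≤ 1 := (div_le_one hs).2 ht.2
    rw [e]
    exact mul_le_of_le_one_right (by positivity) h1
  · rintro ⟨hu, hau⟩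
    refine ⟨3 / Real.pi ^ 2 * u / (x * y), ⟨by positivity, ?_⟩, by field_simp⟩
    rw [div_le_iff₀ (by positivity)]
    calc 3 / Real.pi ^ 2 * u = s * (a * u) := by rw [ha]; field_simp
      _ ≤ _ := by gcongr

/-- Only the row `(1, q)` matters: a translate of the primitive vectors meets the cone as soon as it
does so in the line `u = 1`. -/
lemma image_primitive_inter_nonempty_iff {l s a : ℝ} (hl : 0 < l) (hl1 : l ≤ 1) (hs : 0 < s)
    (ha : a = (Real.pi ^ 2 / 3 * s)⁻¹) (b : ℝ) :
    (((fun v => v ᵥ* hMat b) '' primitive) ∩ coneScaled l (Ioc 0 s)).Nonempty ↔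
      ∃ q : ℤ, a / √l ^ 2 ≤ b + q ∧ b + q ≤ 1 / √l := by
  have hx : 0 < √l := Real.sqrt_pos.2 hl
  have hx1 : √l ≤ 1 := Real.sqrt_le_one.2 hl1
  have ha0 : 0 < a := by rw [ha]; positivity
  set x := √l with hxdef
  constructor
  · rintro ⟨-, ⟨-, ⟨p, q, -, rfl⟩, rfl⟩, hcone⟩
    simp only [vecMul_hMat] at hcone
    rw [mem_coneScaled_iff hl hs ha, ← hxdef] at hcone
    obtain ⟨h1, h2, h3, h4⟩ := hcone
    have hp : 0 < p := by exact_mod_cast h3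
    have hp1 : (1 : ℝ) ≤ p := by exact_mod_cast hp
    -- The largest `m` with `b + m ≤ 1 / x`, the best candidate on the line `u = 1`; it gives `1 - x
    -- < z ≤ 1`.
    set m : ℤ := ⌊1 / x - b⌋
    have hm1 : (m : ℝ) ≤ 1 / x - b := Int.floor_le _
    have hm2 : 1 / x - b < m + 1 := Int.lt_floor_add_one _
    set z := x * (b + m) with hz
    have hz1 : 1 - x < z := by
      have : x * (1 / x - b) < x * (m + 1) := by gcongr
      rw [mul_sub, mul_one_div_cancel hx.ne'] at this
      rw [hz]; linarith
    refine ⟨m, ?_, by linarith⟩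
    rw [div_le_iff₀ (by positivity)]
    by_contra! hlt
    have hlt' : x * z < a := by rw [hz]; nlinarith
    -- Suppose the candidate fails, so `x z < a`. If `q - p m ≤ 0`, the given point violates `a p ≤
    -- x² (p b + q)`; if `q - p m ≥ 1`, then `x (p b + q) ≥ z + x > 1`. Both contradict membership
    -- in the cone.
    have hk : x * (p * b + q) = p * z + x * ((q - p * m : ℤ) : ℝ) := by
      push_cast; rw [hz]; ring
    have hk1 : 1 ≤ q - p * m := by
      by_contra! hk0
      have hk0' : ((q - p * m : ℤ) : ℝ) ≤ 0 := by exact_mod_cast (by omega : q - p * m ≤ 0)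
      have h5 : x * (p * b + q) ≤ p * z := by
        rw [hk]
        have := mul_nonpos_of_nonneg_of_nonpos hx.le hk0'
        linarith
      have h6 : x * (x * (p * b + q)) ≤ x * (p * z) := by gcongr
      have h7 : (p : ℝ) * (x * z) < p * a := by gcongr
      linarith
    have hk1' : (1 : ℝ) ≤ ((q - p * m : ℤ) : ℝ) := by exact_mod_cast hk1
    have h8 : x ≤ x * ((q - p * m : ℤ) : ℝ) := le_mul_of_one_le_right hx.le hk1'
    have h9 : z ≤ p * z := le_mul_of_one_le_left (by linarith) hp1
    linarith
  · rintro ⟨q, h1, h2⟩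
    refine ⟨![1, b + q], ⟨![((1 : ℤ) : ℝ), (q : ℝ)], ⟨1, q, by simp, rfl⟩, ?_⟩, ?_⟩
    · simp only [vecMul_hMat]; simp
    · rw [mem_coneScaled_iff hl hs ha, ← hxdef]
      have h3 : 0 < b + q := lt_of_lt_of_le (by positivity) h1
      rw [div_le_iff₀ (by positivity)] at h1
      rw [le_div_iff₀ hx] at h2
      exact ⟨by positivity, by linarith, one_pos, by nlinarith⟩

/-- The excluded `b` form a closed ball of radius `(β - α) / 2` in the circle, of measure `β - α`
clamped to `[0, 1]`; for `β < α` the ball is empty. -/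
lemma volume_real_forall_not_mem_Icc (α β : ℝ) :
    (volume : Measure ℝ).real {b | b ∈ Ico (0 : ℝ) 1 ∧ ¬ ∃ q : ℤ, α ≤ b + q ∧ b + q ≤ β} =
      max 0 (min 1 (α - β + 1)) := by
  set B : Set UnitAddCircle := Metric.closedBall (((α + β) / 2 : ℝ) : UnitAddCircle) ((β - α) / 2)
  have hB : volume B = ENNReal.ofReal (min 1 (β - α)) := by
    rw [AddCircle.volume_closedBall]; congr 2; ring
  have hpre : ∀ b : ℝ, (b : UnitAddCircle) ∈ B ↔ ∃ q : ℤ, α ≤ b + q ∧ b + q ≤ β := by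
    intro b
    have := AddCircle.coe_real_preimage_closedBall_eq_iUnion (1 : ℝ) ((α + β) / 2) ((β - α) / 2)
    have h : (b : UnitAddCircle) ∈ B ↔ b ∈ ⋃ z : ℤ, Metric.closedBall ((α + β) / 2 + z • (1 : ℝ))
      ((β - α) / 2) := by rw [← this]; rfl
    rw [h, mem_iUnion]
    simp only [Real.closedBall_eq_Icc, mem_Icc, zsmul_eq_mul, mul_one]
    constructor
    · rintro ⟨z, h1, h2⟩
      exact ⟨-z, by push_cast; linarith, by push_cast; linarith⟩
    · rintro ⟨z, h1, h2⟩
      exact ⟨-z, by push_cast; linarith, by push_cast; linarith⟩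
  have hset : {b | b ∈ Ico (0 : ℝ) 1 ∧ ¬ ∃ q : ℤ, α ≤ b + q ∧ b + q ≤ β} =
      ((fun x : ℝ => (x : UnitAddCircle)) ⁻¹' Bᶜ) ∩ Ico 0 1 := by
    ext b
    rw [mem_ofPred_eq, ← hpre, and_comm]
    rfl
  have hBm : MeasurableSet Bᶜ := Metric.isClosed_closedBall.measurableSet.compl
  rw [hset, measureReal_def]
  have h1 : volume (((fun x : ℝ => (x : UnitAddCircle)) ⁻¹' Bᶜ) ∩ Ico 0 1) = volume Bᶜ := by
    rw [← (UnitAddCircle.measurePreserving_mk 0).measure_preimage hBm.nullMeasurableSet,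
      Measure.restrict_apply' measurableSet_Ioc, zero_add]
    exact measure_congr ((ae_eq_refl _).inter Ico_ae_eq_Ioc)
  rw [h1, prob_compl_eq_one_sub Metric.isClosed_closedBall.measurableSet, hB,
    ENNReal.toReal_sub_of_le (ENNReal.ofReal_le_one.2 (min_le_left _ _)) ENNReal.one_ne_top,
    ENNReal.toReal_one, ENNReal.toReal_ofReal']
  rcases le_total 1 (β - α) with h | h
  · rw [min_eq_left h, max_eq_left zero_le_one, max_eq_left (min_le_of_right_le (by linarith))]
    norm_num
  · rw [min_eq_right h]
    rcases le_total 0 (β - α) with h' | h'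
    · rw [max_eq_left h', min_eq_right (by linarith), max_eq_right (by linarith)]; ring
    · rw [max_eq_right h', min_eq_left (by linarith), max_eq_right zero_le_one]; norm_num

/-- Apply the measure formula with `α = a / l` and `β = 1 / √l`: the same profile as in the count of
denominators, with `√l` in the role of `q / Q`. -/
lemma p0_eq_gapProfile {l s a : ℝ} (hl : 0 < l) (hl1 : l ≤ 1) (hs : 0 < s)
    (ha : a = (Real.pi ^ 2 / 3 * s)⁻¹) :
    p0 0 (coneScaled l (Ioc 0 s)) = gapProfile a √l := by
  rw [p0, gapProfile, ← volume_real_forall_not_mem_Icc]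
  congr 1
  ext b
  rw [mem_ofPred_eq, mem_ofPred_eq, ← image_primitive_inter_nonempty_iff hl hl1 hs ha,
    Set.not_nonempty_iff_eq_empty, Nat.cast_zero, Set.encard_eq_zero]

lemma P0_eq_integral {s a : ℝ} (hs : 0 < s) (ha : a = (Real.pi ^ 2 / 3 * s)⁻¹) :
    P0 0 (Ioc 0 s) = ∫ t in (0 : ℝ)..1, 2 * t * gapProfile a t := by
  have ha0 : 0 < a := by rw [ha]; positivity
  have h1 : P0 0 (Ioc 0 s) = ∫ l in (0 : ℝ)..1, gapProfile a √l := by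
    rw [P0]
    refine intervalIntegral.integral_congr_ae (ae_of_all _ fun l hl => ?_)
    rw [uIoc_of_le zero_le_one] at hl
    exact p0_eq_gapProfile hl.1 hl.2 hs ha
  have h2 := intervalIntegral.integral_comp_mul_deriv (a := 0) (b := 1) (f := fun t : ℝ => t ^ 2)
    (f' := fun t => 2 * t) (g := fun l => gapProfile a √l)
    (fun t _ => by simpa using hasDerivAt_pow 2 t) (by fun_prop)
    ((continuous_gapProfile ha0).comp Real.continuous_sqrt)
  simp only [Function.comp_apply] at h2
  rw [h1]
  norm_num at h2
  rw [← h2]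
  refine intervalIntegral.integral_congr fun t ht => ?_
  rw [uIcc_of_le zero_le_one] at ht
  simp only [Real.sqrt_sq ht.1]
  ring

end HorocycleSection

/-! ### Evaluation of the integral and its derivative -/

section ExplicitFormula

/-- The limiting gap distribution as a function of `a`. -/
def gapIntegral (a : ℝ) : ℝ := ∫ t in (0 : ℝ)..1, 2 * t * gapProfile a t

lemma intervalIntegrable_gapProfile {a : ℝ} (ha : 0 < a) (u v : ℝ) :
    IntervalIntegrable (fun t => 2 * t * gapProfile a t) volume u v :=
  ((by fun_prop : Continuous fun t : ℝ => 2 * t).mul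
    (continuous_gapProfile ha)).intervalIntegrable u v

lemma integral_gapProfile_of_le {a v : ℝ} (hv : 0 ≤ v) (hva : v ≤ a) :
    ∫ t in (0 : ℝ)..v, 2 * t * gapProfile a t = v ^ 2 := by
  have : ∫ t in (0 : ℝ)..v, 2 * t * gapProfile a t = ∫ t in (0 : ℝ)..v, 2 * t := by
    refine intervalIntegral.integral_congr fun t ht => ?_
    rw [uIcc_of_le hv] at ht
    simp only [gapProfile_eq_one (ht.2.trans hva), mul_one]
  rw [this, intervalIntegral.integral_const_mul, integral_id]
  ring

/-- The primitive of `2 t g(t)` where `g` is given by the middle expression. -/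
def gapPrimitive (a t : ℝ) : ℝ := 2 * a * Real.log t - 2 * t + t ^ 2

lemma integral_gapProfile_middle {a u v : ℝ} (hu : 0 < u) (huv : u ≤ v) (hau : a ≤ u)
    (hmid : ∀ t ∈ Icc u v, 0 ≤ t ^ 2 - t + a) :
    ∫ t in u..v, 2 * t * gapProfile a t = gapPrimitive a v - gapPrimitive a u := by
  have h1 : ∫ t in u..v, 2 * t * gapProfile a t = ∫ t in u..v, (2 * a * t⁻¹ - 2 + 2 * t) := by
    refine intervalIntegral.integral_congr fun t ht => ?_
    rw [uIcc_of_le huv] at ht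
    have ht0 : 0 < t := hu.trans_le ht.1
    have e : a / t ^ 2 - 1 / t + 1 = (t ^ 2 - t + a) / t ^ 2 := by field_simp; ring
    have h2 : (t ^ 2 - t + a) / t ^ 2 ≤ 1 := by
      rw [div_le_one (by positivity)]; linarith [ht.1]
    have h3 : 0 ≤ (t ^ 2 - t + a) / t ^ 2 := div_nonneg (hmid t ht) (by positivity)
    simp only [gapProfile]
    rw [e, min_eq_right h2, max_eq_right h3]
    field_simp
    ring
  rw [h1]
  apply intervalIntegral.integral_eq_sub_of_hasDerivAt
  · intro t ht
    rw [uIcc_of_le huv] at ht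
    have ht0 : t ≠ 0 := (hu.trans_le ht.1).ne'
    have := (((Real.hasDerivAt_log ht0).const_mul (2 * a)).sub
      ((hasDerivAt_id t).const_mul 2)).add (hasDerivAt_pow 2 t)
    exact this.congr_deriv (by simp)
  · apply ContinuousOn.intervalIntegrable
    rw [uIcc_of_le huv]
    intro t ht
    have ht0 : t ≠ 0 := (hu.trans_le ht.1).ne'
    apply ContinuousAt.continuousWithinAt
    exact ((continuousAt_const.mul (continuousAt_inv₀ ht0)).sub continuousAt_const).add
      (continuousAt_const.mul continuousAt_id)

lemma gapIntegral_of_one_le {a : ℝ} (ha : 1 ≤ a) : gapIntegral a = 1 := by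
  rw [gapIntegral, integral_gapProfile_of_le zero_le_one ha]; norm_num

/-- The profile is `1` up to `t = a`. Beyond, `t² - t + a = (t - 1/2)² + a - 1/4 ≥ 0`, so the lower
clamp never acts. -/
lemma gapIntegral_of_mem_Icc {a : ℝ} (ha : 1 / 4 ≤ a) (ha1 : a ≤ 1) :
    gapIntegral a = -1 + 2 * a - 2 * a * Real.log a := by
  have ha0 : 0 < a := by linarith
  rw [gapIntegral, ← intervalIntegral.integral_add_adjacent_intervals
    (intervalIntegrable_gapProfile ha0 0 a) (intervalIntegrable_gapProfile ha0 a 1),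
    integral_gapProfile_of_le ha0.le le_rfl,
    integral_gapProfile_middle ha0 ha1 le_rfl (fun t _ => by nlinarith [sq_nonneg (t - 1 / 2)])]
  simp only [gapPrimitive, Real.log_one]
  ring

/-- The roots of `t² - t + a` are `1/2 ± w`, and the profile vanishes between them. Their product is
`a`, so `a ≤ 1/2 - w` and `log a` splits into the logarithms of the roots. -/
lemma gapIntegral_of_le_quarter {a : ℝ} (ha0 : 0 < a) (ha : a ≤ 1 / 4) :
    gapIntegral a = -1 + 2 * a + 2 * √(1 / 4 - a) - 4 * a * Real.log (1 / 2 + √(1 / 4 - a)) := by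
  set w := √(1 / 4 - a) with hw
  have hw0 : 0 ≤ w := Real.sqrt_nonneg _
  have hw2 : w ^ 2 = 1 / 4 - a := Real.sq_sqrt (by linarith)
  have hw1 : w < 1 / 2 := by nlinarith
  have haw : a = (1 / 2 - w) * (1 / 2 + w) := by linarith
  have h1 : a ≤ 1 / 2 - w := by nlinarith
  have hi := intervalIntegrable_gapProfile ha0
  have hmid : ∫ t in (1 / 2 - w)..(1 / 2 + w), 2 * t * gapProfile a t = 0 := by
    have : ∫ t in (1 / 2 - w)..(1 / 2 + w), 2 * t * gapProfile a t =
        ∫ t in (1 / 2 - w)..(1 / 2 + w), (0 : ℝ) := by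
      refine intervalIntegral.integral_congr fun t ht => ?_
      rw [uIcc_of_le (by linarith)] at ht
      have ht0 : 0 < t := by linarith [ht.1]
      have e : a / t ^ 2 - 1 / t + 1 = (t ^ 2 - t + a) / t ^ 2 := by field_simp; ring
      have h2 : (t ^ 2 - t + a) / t ^ 2 ≤ 0 :=
        div_nonpos_of_nonpos_of_nonneg (by nlinarith [ht.1, ht.2]) (by positivity)
      simp only [gapProfile]
      rw [e, max_eq_left ((min_le_right _ _).trans h2), mul_zero]
    rw [this]; simp
  have hlog : Real.log a = Real.log (1 / 2 - w) + Real.log (1 / 2 + w) := by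
    rw [← Real.log_mul (by linarith) (by linarith), ← haw]
  rw [gapIntegral, ← intervalIntegral.integral_add_adjacent_intervals (hi 0 a) (hi a 1),
    ← intervalIntegral.integral_add_adjacent_intervals (hi a (1 / 2 - w)) (hi (1 / 2 - w) 1),
    ← intervalIntegral.integral_add_adjacent_intervals (hi (1 / 2 - w) (1 / 2 + w))
      (hi (1 / 2 + w) 1),
    integral_gapProfile_of_le ha0.le le_rfl, hmid,
    integral_gapProfile_middle ha0 h1 le_rfl (fun t ht => by nlinarith [ht.1, ht.2]),
    integral_gapProfile_middle (by linarith) (by linarith) (by linarith)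
      (fun t ht => by nlinarith [ht.1, ht.2])]
  simp only [gapPrimitive, Real.log_one, hlog]
  ring

lemma hasDerivAt_gapFormula_middle {a : ℝ} (ha : a ≠ 0) :
    HasDerivAt (fun a : ℝ => -1 + 2 * a - 2 * a * Real.log a) (-2 * Real.log a) a := by
  have h1 := ((hasDerivAt_id a).const_mul 2)
  have := (h1.const_add (-1)).sub (h1.mul (Real.hasDerivAt_log ha))
  refine HasDerivAt.congr_deriv this ?_
  simp only [id]
  field_simp
  ring

/-- With `w = √(1/4 - a)` and `a = (1/2 - w)(1/2 + w)`, the terms in `1 / w` cancel. The derivative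
therefore stays bounded as `a → 1/4`, although the square root is singular there. -/
lemma hasDerivAt_gapFormula_small {a : ℝ} (ha : a < 1 / 4) :
    HasDerivAt (fun a : ℝ => -1 + 2 * a + 2 * √(1 / 4 - a) - 4 * a * Real.log (1 / 2 + √(1 / 4 - a)))
      (-4 * Real.log (1 / 2 + √(1 / 4 - a))) a := by
  have hw : HasDerivAt (fun a : ℝ => √(1 / 4 - a)) (-1 / (2 * √(1 / 4 - a))) a :=
    ((hasDerivAt_id a).const_sub (1 / 4)).sqrt (by simp only [id]; linarith)
  have hw0 : 0 < √(1 / 4 - a) := Real.sqrt_pos.2 (by linarith)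
  have hw2 : √(1 / 4 - a) ^ 2 = 1 / 4 - a := Real.sq_sqrt (by linarith)
  have hlog := (hw.const_add (1 / 2)).log (by positivity)
  have h1 := (hasDerivAt_id a)
  have := (((h1.const_mul 2).const_add (-1)).add (hw.const_mul 2)).sub ((h1.const_mul 4).mul hlog)
  refine HasDerivAt.congr_deriv this ?_
  simp only [id]
  set w := √(1 / 4 - a)
  have haw : a = (1 / 2 - w) * (1 / 2 + w) := by linarith
  rw [haw]
  field_simp
  ring

lemma hasDerivAt_gapIntegral_of_one_le {a : ℝ} (ha : 1 ≤ a) : HasDerivAt gapIntegral 0 a := by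
  have hr : HasDerivWithinAt gapIntegral 0 (Ici 1) a :=
    (hasDerivWithinAt_const a _ (1 : ℝ)).congr (fun y hy => gapIntegral_of_one_le hy)
      (gapIntegral_of_one_le ha)
  rcases ha.eq_or_lt with rfl | h
  -- At the junction `a = 1` the one-sided derivatives agree because `log 1 = 0`.
  · have hl : HasDerivWithinAt gapIntegral 0 (Icc (1 / 4) 1) 1 := by
      have := (hasDerivAt_gapFormula_middle (one_ne_zero)).hasDerivWithinAt (s := Icc (1 / 4) 1)
      rw [Real.log_one, mul_zero] at this
      exact this.congr (fun y hy => gapIntegral_of_mem_Icc hy.1 hy.2)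
        (gapIntegral_of_mem_Icc (by norm_num) le_rfl)
    refine (hl.union hr).hasDerivAt ?_
    filter_upwards [Ici_mem_nhds (show (1 / 4 : ℝ) < 1 by norm_num)] with y hy
    rcases le_total y 1 with h | h
    · exact Or.inl ⟨hy, h⟩
    · exact Or.inr h
  · exact hr.hasDerivAt (Ici_mem_nhds h)

lemma hasDerivAt_gapIntegral_of_le_quarter {a : ℝ} (ha0 : 0 < a) (ha : a ≤ 1 / 4) :
    HasDerivAt gapIntegral (-4 * Real.log (1 / 2 + √(1 / 4 - a))) a := by
  rcases ha.lt_or_eq with h | rfl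
  · refine (hasDerivAt_gapFormula_small h).congr_of_eventuallyEq ?_
    filter_upwards [Ioo_mem_nhds ha0 h] with y hy
    exact gapIntegral_of_le_quarter hy.1 hy.2.le
  · set F : ℝ → ℝ := fun a : ℝ =>
      -1 + 2 * a + 2 * √(1 / 4 - a) - 4 * a * Real.log (1 / 2 + √(1 / 4 - a)) with hF
    have hFc : ContinuousAt F (1 / 4) := by
      have hs : ContinuousAt (fun a : ℝ => √(1 / 4 - a)) (1 / 4) := by fun_prop
      have hlog : ContinuousAt (fun a : ℝ => Real.log (1 / 2 + √(1 / 4 - a))) (1 / 4) :=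
        (continuousAt_const.add hs).log (ne_of_gt (by
            change (0 : ℝ) < 1 / 2 + √(1 / 4 - 1 / 4)
            linarith [Real.sqrt_nonneg ((1 : ℝ) / 4 - 1 / 4)]))
      simp only [hF]
      fun_prop
    -- At `a = 1/4` the formula cannot be differentiated termwise; the left derivative is obtained
    -- as the limit of the derivatives at `y < 1/4`.
    have hl : HasDerivWithinAt F (-4 * Real.log (1 / 2 + √(1 / 4 - 1 / 4))) (Iic (1 / 4)) (1 / 4) := by
      refine hasDerivWithinAt_Iic_of_tendsto_deriv (s := Ioo 0 (1 / 4)) ?_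
        hFc.continuousWithinAt (Ioo_mem_nhdsLT (by norm_num)) ?_
      · intro y hy
        exact (hasDerivAt_gapFormula_small hy.2).differentiableAt.differentiableWithinAt
      · have hc : ContinuousAt (fun a : ℝ => -4 * Real.log (1 / 2 + √(1 / 4 - a))) (1 / 4) := by
          have hs : ContinuousAt (fun a : ℝ => √(1 / 4 - a)) (1 / 4) := by fun_prop
          exact continuousAt_const.mul ((continuousAt_const.add hs).log (ne_of_gt (by
            change (0 : ℝ) < 1 / 2 + √(1 / 4 - 1 / 4)
            linarith [Real.sqrt_nonneg ((1 : ℝ) / 4 - 1 / 4)])))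
        refine (hc.tendsto.mono_left nhdsWithin_le_nhds).congr' ?_
        filter_upwards [Ioo_mem_nhdsLT (show (0 : ℝ) < 1 / 4 by norm_num)] with y hy
        exact (hasDerivAt_gapFormula_small hy.2).deriv.symm
    have hl' : HasDerivWithinAt gapIntegral (-4 * Real.log (1 / 2 + √(1 / 4 - 1 / 4)))
        (Ioc 0 (1 / 4)) (1 / 4) :=
      (hl.mono fun y hy => hy.2).congr (fun y hy => gapIntegral_of_le_quarter hy.1 hy.2)
        (gapIntegral_of_le_quarter ha0 le_rfl)
    have hr : HasDerivWithinAt gapIntegral (-4 * Real.log (1 / 2 + √(1 / 4 - 1 / 4)))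
        (Icc (1 / 4) 1) (1 / 4) := by
      have := (hasDerivAt_gapFormula_middle ha0.ne').hasDerivWithinAt (s := Icc (1 / 4) 1)
      -- The one-sided derivatives match because `1/4 = (1/2)²`.
      have e : -2 * Real.log (1 / 4) = -4 * Real.log (1 / 2 + √(1 / 4 - 1 / 4)) := by
        rw [sub_self, Real.sqrt_zero, add_zero, show (1 / 4 : ℝ) = (1 / 2) ^ 2 by norm_num,
          Real.log_pow]
        push_cast; ring
      rw [e] at this
      exact this.congr (fun y hy => gapIntegral_of_mem_Icc hy.1 hy.2)
        (gapIntegral_of_mem_Icc le_rfl (by norm_num))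
    refine (hl'.union hr).hasDerivAt ?_
    filter_upwards [Ioo_mem_nhds ha0 (show (1 / 4 : ℝ) < 1 by norm_num)] with y hy
    rcases le_total y (1 / 4) with h | h
    · exact Or.inl ⟨hy.1, h⟩
    · exact Or.inr ⟨h, hy.2.le⟩

lemma hasDerivAt_gapIntegral_of_mem_Icc {a : ℝ} (ha : 1 / 4 ≤ a) (ha1 : a ≤ 1) :
    HasDerivAt gapIntegral (-2 * Real.log a) a := by
  rcases ha1.eq_or_lt with rfl | h1
  · simpa using hasDerivAt_gapIntegral_of_one_le le_rfl
  rcases ha.eq_or_lt with rfl | h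
  · convert hasDerivAt_gapIntegral_of_le_quarter (a := 1 / 4) (by norm_num) le_rfl using 1
    rw [sub_self, Real.sqrt_zero, add_zero, show (1 / 4 : ℝ) = (1 / 2) ^ 2 by norm_num,
      Real.log_pow]
    push_cast; ring
  · refine (hasDerivAt_gapFormula_middle (by linarith)).congr_of_eventuallyEq ?_
    filter_upwards [Ioo_mem_nhds h h1] with y hy
    exact gapIntegral_of_mem_Icc hy.1.le hy.2.le

/-- Chain rule with `da/ds = -(π² / 3) a²`. -/
lemma hasDerivAt_neg_P0 {s a E : ℝ} (hs : 0 < s) (ha : a = (Real.pi ^ 2 / 3 * s)⁻¹)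
    (h : HasDerivAt gapIntegral E a) :
    HasDerivAt (fun t : ℝ => -P0 0 (Ioc 0 t)) (E * (Real.pi ^ 2 / 3 * a ^ 2)) s := by
  have h1 : HasDerivAt (fun t : ℝ => (Real.pi ^ 2 / 3 * t)⁻¹) (-(Real.pi ^ 2 / 3 * a ^ 2)) s := by
    have h2 := ((hasDerivAt_id s).const_mul (Real.pi ^ 2 / 3)).inv (by simp only [id]; positivity)
    refine HasDerivAt.congr_deriv h2 ?_
    simp only [id]
    rw [ha]
    field_simp
  have h3 := (HasDerivAt.comp s (ha ▸ h) h1).neg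
  have h4 : HasDerivAt (fun t : ℝ => -P0 0 (Ioc 0 t)) (-(E * -(Real.pi ^ 2 / 3 * a ^ 2))) s := by
    refine h3.congr_of_eventuallyEq ?_
    filter_upwards [lt_mem_nhds hs] with t ht
    simp only [Pi.neg_apply, Function.comp_apply]
    rw [P0_eq_integral ht rfl]
    rfl
  convert h4 using 1
  ring

end ExplicitFormula

end Farey

theorem mainTheorem3 (s a : ℝ) (hs : 0 < s) (ha : a = (Real.pi ^ 2 / 3 * s)⁻¹) :
    -- `P_0(0, (0, s])` is the limiting gap distribution, whatever the test set `D`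
    (∀ D : Set UnitAddCircle, volume (frontier D) = 0 → (interior D).Nonempty →
      Tendsto (fun Q : ℕ => Farey.P0Q Q 0 D (Ioc 0 s)) atTop (𝓝 (Farey.P0 0 (Ioc 0 s)))) ∧
    -- its explicit value
    (1 ≤ a → Farey.P0 0 (Ioc 0 s) = 1) ∧
    (1 / 4 ≤ a → a ≤ 1 → Farey.P0 0 (Ioc 0 s) = -1 + 2 * a - 2 * a * Real.log a) ∧
    (a ≤ 1 / 4 → Farey.P0 0 (Ioc 0 s) =
      -1 + 2 * a + 2 * Real.sqrt (1 / 4 - a)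
        - 4 * a * Real.log (1 / 2 + Real.sqrt (1 / 4 - a))) ∧
    -- its density `-d/ds P_0(0, (0, s])`
    (1 ≤ a → HasDerivAt (fun t : ℝ => -Farey.P0 0 (Ioc 0 t)) 0 s) ∧
    (1 / 4 ≤ a → a ≤ 1 → HasDerivAt (fun t : ℝ => -Farey.P0 0 (Ioc 0 t))
      (-(2 * Real.pi ^ 2 / 3) * a ^ 2 * Real.log a) s) ∧
    (a ≤ 1 / 4 → HasDerivAt (fun t : ℝ => -Farey.P0 0 (Ioc 0 t))
      (-(4 * Real.pi ^ 2 / 3) * a ^ 2 * Real.log (1 / 2 + Real.sqrt (1 / 4 - a))) s) := by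
  have ha0 : 0 < a := by rw [ha]; positivity
  have hP : Farey.P0 0 (Ioc 0 s) = Farey.gapIntegral a := Farey.P0_eq_integral hs ha
  refine ⟨fun D hD hDi => ?_, fun h => ?_, fun h h' => ?_, fun h => ?_, fun h => ?_,
    fun h h' => ?_, fun h => ?_⟩
  · rw [hP]
    exact Farey.tendsto_P0Q hs ha hD hDi
  · rw [hP, Farey.gapIntegral_of_one_le h]
  · rw [hP, Farey.gapIntegral_of_mem_Icc h h']
  · rw [hP, Farey.gapIntegral_of_le_quarter ha0 h]
  · simpa using Farey.hasDerivAt_neg_P0 hs ha (Farey.hasDerivAt_gapIntegral_of_one_le h)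
  · convert Farey.hasDerivAt_neg_P0 hs ha (Farey.hasDerivAt_gapIntegral_of_mem_Icc h h') using 1
    ring
  · convert Farey.hasDerivAt_neg_P0 hs ha (Farey.hasDerivAt_gapIntegral_of_le_quarter ha0 h) using 1
    ring

end
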